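/- Let $\mathbb{H}^1$ be the first Heisenberg group, i.e. $\mathbb{R}^3$ with the group law $(x,y,t)(x',y',t')=(x+x',y+y',t+t'-2xy'+2x'y)$ and with Lebesgue measure $m$. Let $d_{\mathbb{H}^1}(p,q)=\|q^{-1}p\|$, where $\|(x,y,t)\|=((x^2+y^2)^2+t^2)^{1/4}$, be the Korányi distance, and let $d_s(p,q)$ be the sub-Riemannian distance, i.e. the infimum of $\int_0^1\sqrt{\dot\gamma_1^2+\dot\gamma_2^2}\,ds$ over all absolutely continuous curves $\gamma=(\gamma_1,\gamma_2,\gamma_3):[0,1]\to\mathbb{R}^3$ from $p$ to $q$ with $\dot\gamma(s)\in\mathrm{span}\{X_{\gamma(s)},Y_{\gamma(s)}\}$ for almost every $s$, where $X=\partial_x+2y\,\partial_t$ and $Y=\partial_y-2x\,\partial_t$. For $d\in\{d_{\mathbb{H}^1},d_s\}$, an open set $\Omega\subseteq\mathbb{H}^1$, a real number $n>1$ and $u\in L^1_{loc}(\Omega)$ put $$\|u\|_{\mathrm{BMO}^d(\Omega)}=\sup_{B\subseteq\Omega}\frac1{|B|}\int_B|u-u_B|\,dm,\qquad \|u\|_{\mathrm{BMO}^d_{n,loc}(\Omega)}=\sup_{nB\subseteq\Omega}\frac1{|B|}\int_B|u-u_B|\,dm,$$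 where $u_B=\frac1{|B|}\int_B u\,dm$, the suprema are over open $d$-balls $B=B(c,r)$, $r>0$, with $B\subseteq\Omega$, respectively with $nB:=B(c,nr)\subseteq\Omega$, and the mean oscillation over $B$ is understood to be $+\infty$ if $u$ is not integrable on $B$. Let $\mathrm{BMO}^d(\Omega)$ and $\mathrm{BMO}^d_{n,loc}(\Omega)$ be the sets of all $u\in L^1_{loc}(\Omega)$ for which the respective supremum is finite. **Theorem.** 1. For every $n>1$ there is a constant $C<\infty$, depending only on $n$, such that for every open set $\Omega\subseteq\mathbb{H}^1$ and all $d,d'\in\{d_{\mathbb{H}^1},d_s\}$ (equal or different) $$\mathrm{BMO}^d(\Omega)=\mathrm{BMO}^{d'}_{n,loc}(\Omega)\quad\text{and}\quad \|u\|_{\mathrm{BMO}^d(\Omega)}\le C\,\|u\|_{\mathrm{BMO}^{d'}_{n,loc}(\Omega)}\ \text{ for all } u\in L^1_{loc}(\Omega).$$ 2. For every open set $\Omega\subseteq\mathbb{H}^1$, $\mathrm{BMO}^{d_s}(\Omega)=\mathrm{BMO}^{d_{\mathbb{H}^1}}(\Omega)$. 3. There are universal constants $0<c_1\le c_2<\infty$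 such that for every open set $\Omega\subseteq\mathbb{H}^1$ and every $u\in L^1_{loc}(\Omega)$ $$c_1\|u\|_{\mathrm{BMO}^{d_{\mathbb{H}^1}}(\Omega)}\le\|u\|_{\mathrm{BMO}^{d_s}(\Omega)}\le c_2\|u\|_{\mathrm{BMO}^{d_{\mathbb{H}^1}}(\Omega)}.$$ -/

import Mathlib

open MeasureTheory Set
open scoped ENNReal NNReal

/-- The first Heisenberg group: `ℝ³` with coordinates `(x, y, t)`, its usual topology and
Lebesgue measure. The (non-commutative) group law is given below. -/
def Heis : Type := ℝ × ℝ × ℝ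

namespace Heis

/-- The point with coordinates `(x, y, t)`. -/
def mk (x y t : ℝ) : Heis := (x, y, t)

/-- First coordinate. -/
def x (p : Heis) : ℝ := Prod.fst p

/-- Second coordinate. -/
def y (p : Heis) : ℝ := Prod.fst (Prod.snd p)

/-- Third coordinate. -/
def t (p : Heis) : ℝ := Prod.snd (Prod.snd p)

@[simp] theorem x_mk (a b c : ℝ) : (mk a b c).x = a := rfl
@[simp] theorem y_mk (a b c : ℝ) : (mk a b c).y = b := rfl
@[simp] theorem t_mk (a b c : ℝ) : (mk a b c).t = c := rfl

theorem ext_coord {p q : Heis} (hx : p.x = q.x) (hy : p.y = q.y) (ht : p.t = q.t) : p = q :=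
  Prod.ext hx (Prod.ext hy ht)

instance : TopologicalSpace Heis := inferInstanceAs (TopologicalSpace (ℝ × ℝ × ℝ))

/-- `volume` on `Heis` is the Lebesgue measure of `ℝ³`. -/
noncomputable instance : MeasureSpace Heis := inferInstanceAs (MeasureSpace (ℝ × ℝ × ℝ))

instance : BorelSpace Heis := inferInstanceAs (BorelSpace (ℝ × ℝ × ℝ))

noncomputable instance : Mul Heis :=
  ⟨fun p q => mk (p.x + q.x) (p.y + q.y) (p.t + q.t - 2 * p.x * q.y + 2 * q.x * p.y)⟩

noncomputable instance : One Heis := ⟨mk 0 0 0⟩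

noncomputable instance : Inv Heis := ⟨fun p => mk (-p.x) (-p.y) (-p.t)⟩

@[simp] theorem mul_x (p q : Heis) : (p * q).x = p.x + q.x := rfl
@[simp] theorem mul_y (p q : Heis) : (p * q).y = p.y + q.y := rfl
@[simp] theorem mul_t (p q : Heis) :
    (p * q).t = p.t + q.t - 2 * p.x * q.y + 2 * q.x * p.y := rfl
@[simp] theorem one_x : (1 : Heis).x = 0 := rfl
@[simp] theorem one_y : (1 : Heis).y = 0 := rfl
@[simp] theorem one_t : (1 : Heis).t = 0 := rfl
@[simp] theorem inv_x (p : Heis) : (p⁻¹).x = -p.x := rfl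
@[simp] theorem inv_y (p : Heis) : (p⁻¹).y = -p.y := rfl
@[simp] theorem inv_t (p : Heis) : (p⁻¹).t = -p.t := rfl

noncomputable instance : Group Heis :=
  Group.ofLeftAxioms
    (fun p q r => ext_coord (by simp; ring) (by simp; ring) (by simp; ring))
    (fun p => ext_coord (by simp) (by simp) (by simp))
    (fun p => ext_coord (by simp) (by simp) (by simp))

/-- The Korányi norm `((x² + y²)² + t²)^{1/4}`. -/
noncomputable def koranyiNorm (p : Heis) : ℝ :=
  ((p.x ^ 2 + p.y ^ 2) ^ 2 + p.t ^ 2) ^ (1 / 4 : ℝ)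

/-- The Korányi distance `d(p, q) = ‖q⁻¹ p‖`. -/
noncomputable def koranyiDist (p q : Heis) : ℝ := koranyiNorm (q⁻¹ * p)

/-- The value at `p` of the left-invariant vector field `X = ∂_x + 2y ∂_t`, in coordinates. -/
def fieldX (p : Heis) : ℝ × ℝ × ℝ := (1, 0, 2 * p.y)

/-- The value at `p` of the left-invariant vector field `Y = ∂_y - 2x ∂_t`, in coordinates. -/
def fieldY (p : Heis) : ℝ × ℝ × ℝ := (0, 1, -2 * p.x)

/-- The horizontal plane at `p`. -/
def horizontalPlane (p : Heis) : Submodule ℝ (ℝ × ℝ × ℝ) :=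
  Submodule.span ℝ {fieldX p, fieldY p}

/-- `γ : [0,1] → ℍ¹` is a horizontal curve: it is absolutely continuous and its velocity lies in
the horizontal plane almost everywhere. (Only the values of `γ` on `[0,1]` matter.) -/
def IsHorizontalCurve (γ : ℝ → Heis) : Prop :=
  AbsolutelyContinuousOnInterval (fun s => (γ s).x) 0 1 ∧
  AbsolutelyContinuousOnInterval (fun s => (γ s).y) 0 1 ∧
  AbsolutelyContinuousOnInterval (fun s => (γ s).t) 0 1 ∧
  ∀ᵐ s ∂(volume.restrict (Icc (0 : ℝ) 1)),
    (deriv (fun s => (γ s).x) s, deriv (fun s => (γ s).y) s, deriv (fun s => (γ s).t) s) ∈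
      horizontalPlane (γ s)

/-- The length of a horizontal curve (its velocity is integrable, by absolute continuity). -/
noncomputable def horizontalLength (γ : ℝ → Heis) : ℝ :=
  ∫ s in (0 : ℝ)..1,
    Real.sqrt (deriv (fun s => (γ s).x) s ^ 2 + deriv (fun s => (γ s).y) s ^ 2)

/-- The sub-Riemannian distance: the infimum of the lengths of the horizontal curves from `p`
to `q`. -/
noncomputable def subRiemDist (p q : Heis) : ℝ :=
  sInf {L : ℝ | ∃ γ : ℝ → Heis,
    IsHorizontalCurve γ ∧ γ 0 = p ∧ γ 1 = q ∧ L = horizontalLength γ}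

/-- The open ball `B(c, r)` of a distance function `d`. -/
def dball (d : Heis → Heis → ℝ) (c : Heis) (r : ℝ) : Set Heis := {p | d p c < r}

/-- The mean oscillation `⨍_B |u - u_B|` with `u_B = ⨍_B u`, as an extended nonnegative number.
If `B` has positive finite measure and `u` is measurable but not integrable on `B`, so that `u_B`
is not defined, the value is `∞` (see `meanOsc_eq_top`). -/
noncomputable def meanOsc (u : Heis → ℝ) (B : Set Heis) : ℝ≥0∞ :=
  ⨍⁻ p in B, ‖u p - ⨍ q in B, u q‖ₑ ∂volume

theorem meanOsc_eq_top {u : Heis → ℝ} {B : Set Heis}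
    (hu : AEStronglyMeasurable u (volume.restrict B))
    (hB : volume B ≠ ∞) (hn : ¬ IntegrableOn u B) : meanOsc u B = ∞ := by
  have h1 : ⨍ q in B, u q = 0 := by
    rw [setAverage_eq, integral_undef hn, smul_zero]
  have h2 : ∫⁻ p in B, ‖u p‖ₑ = ∞ := by
    by_contra h
    exact hn ⟨hu, lt_top_iff_ne_top.mpr h⟩
  rw [meanOsc, h1, setLAverage_eq]
  simp only [sub_zero, h2]
  exact ENNReal.top_div_of_ne_top hB

/-- `u ∈ BMO(Ω)` with respect to the distance `d`: `u ∈ L¹_loc(Ω)` and the mean oscillations of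
`u` on the `d`-balls contained in `Ω` are bounded. Functions on `Ω` are represented by functions on
`ℍ¹`, whose values outside `Ω` play no role. -/
def BMO (d : Heis → Heis → ℝ) (Ω : Set Heis) : Set (Heis → ℝ) :=
  {u | LocallyIntegrableOn u Ω ∧ ∃ C : ℝ≥0, ∀ (c : Heis) (r : ℝ), 0 < r →
    dball d c r ⊆ Ω → meanOsc u (dball d c r) ≤ C}

/-- `u ∈ BMO_{n,loc}(Ω)`: only the balls `B = B(c, r)` with `nB = B(c, nr) ⊆ Ω` are considered. -/
def BMOloc (d : Heis → Heis → ℝ) (n : ℝ) (Ω : Set Heis) : Set (Heis → ℝ) :=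
  {u | LocallyIntegrableOn u Ω ∧ ∃ C : ℝ≥0, ∀ (c : Heis) (r : ℝ), 0 < r →
    dball d c (n * r) ⊆ Ω → meanOsc u (dball d c r) ≤ C}

/-- The `BMO(Ω)`-seminorm: the supremum of the mean oscillations over the balls in `Ω`. -/
noncomputable def bmoNorm (d : Heis → Heis → ℝ) (Ω : Set Heis) (u : Heis → ℝ) : ℝ≥0∞ :=
  ⨆ (c : Heis) (r : ℝ) (_ : 0 < r) (_ : dball d c r ⊆ Ω), meanOsc u (dball d c r)

/-- The `BMO_{n,loc}(Ω)`-seminorm: the supremum over the balls `B` with `nB ⊆ Ω`. -/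
noncomputable def bmoLocNorm (d : Heis → Heis → ℝ) (n : ℝ) (Ω : Set Heis) (u : Heis → ℝ) :
    ℝ≥0∞ :=
  ⨆ (c : Heis) (r : ℝ) (_ : 0 < r) (_ : dball d c (n * r) ⊆ Ω), meanOsc u (dball d c r)

end Heis

/-!
The theorem is a local-to-global principle for mean oscillations on balls that are John domains.

Both distances are left-invariant, homogeneous under the dilations `(x, y, t) ↦ (R x, R y, R² t)`
and comparable with each other (`subRiemDist_le_koranyiDist`, `koranyiDist_le_subRiemDist`). They
are treated together as instances of `IsHomDist`; triangle inequalities are always those of the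
sub-Riemannian distance, where they come from joining curves.

Let `D` be a ball of one distance contained in `Ω`, and let the oscillations of `u` over balls of
the other distance whose `n`-fold enlargements lie in `D` be at most `M`. For a point `p` of `D`,
consider the mean of `u` over a ball around `p` whose radius is a small multiple of the distance
from `p` to the complement of `D`. If `q` is close to `p` at this scale, the two means differ by
`O(M)`, because both small balls lie in one admissible ball of comparable measure
(`IsHomDist.enorm_localMean_sub_le`). Hence, if a chain of `k` such steps connects `p` to the
centre `c` of `D`, the means at `p` and at `c` differ by `O(k M)`.

That `k` is at most logarithmic in the relative distance of `p` to the boundary is the geometric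
part (`HasJohnBalls`). For the sub-Riemannian distance one follows an almost shortest path to the
centre. For the Korányi distance, with `F = (x² + y²)² + t²`, the quantity `1 - F` is made to grow
by a fixed factor in each step: away from the vertical axis by a step against the horizontal
gradient of `F`, and near the axis, where this gradient degenerates but the distance to the boundary
is of the order of `√(1 - F)`, by a vertical step.

Finally, `D` is covered by balls of a Vitali family adapted to the distance to the complement, and
the oscillation of `u` over `D` is bounded by the integral over `D` of `M` times the number of steps.
Since by homogeneity the boundary layer of relative width `2⁻ʲ` has measure `O(2⁻ʲ) |D|`
(`IsHomDist.volume_diff_dball_le`), this integral is `O(M |D|)`; see `exists_meanOsc_dball_le`. No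
covering of `D` by admissible balls with bounded overlap and no John-Nirenberg inequality is needed.
-/

namespace Heis

/-! ### Absolutely continuous functions -/

theorem ac_congr {f g : ℝ → ℝ} {a b : ℝ} (hf : AbsolutelyContinuousOnInterval f a b)
    (h : EqOn f g (uIcc a b)) : AbsolutelyContinuousOnInterval g a b := by
  rw [absolutelyContinuousOnInterval_iff] at hf ⊢
  intro ε hε
  obtain ⟨δ, hδ, H⟩ := hf ε hε
  refine ⟨δ, hδ, fun E hE hlt => ?_⟩
  refine lt_of_eq_of_lt (Finset.sum_congr rfl fun i hi => ?_) (H E hE hlt)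
  rw [h (hE.1 i hi).1, h (hE.1 i hi).2]

theorem ac_const (c a b : ℝ) : AbsolutelyContinuousOnInterval (fun _ => c) a b :=
  ContDiffOn.absolutelyContinuousOnInterval contDiffOn_const

theorem ac_of_eq_integral {f g : ℝ → ℝ} {a b : ℝ} (hg : IntervalIntegrable g volume a b)
    (h : ∀ s ∈ uIcc a b, f s = f a + ∫ v in a..s, g v) :
    AbsolutelyContinuousOnInterval f a b := by
  have h1 := (ac_const (f a) a b).add
    (hg.absolutelyContinuousOnInterval_intervalIntegral (c := a) left_mem_uIcc)
  exact ac_congr h1 fun s hs => (h s hs).symm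

theorem ac_eq_integral {f : ℝ → ℝ} {a b : ℝ} (hf : AbsolutelyContinuousOnInterval f a b)
    {s : ℝ} (hs : s ∈ uIcc a b) : f s = f a + ∫ v in a..s, deriv f v := by
  have := (hf.mono (uIcc_subset_uIcc_left hs)).integral_deriv_eq_sub
  linarith

theorem deriv_comp_affine (f : ℝ → ℝ) (a k s : ℝ) :
    deriv (fun s => f (a + k * s)) s = k * deriv f (a + k * s) := by
  have h := deriv_comp_mul_left k (fun u => f (a + u)) s
  rw [smul_eq_mul, deriv_comp_const_add] at h
  exact h

theorem affine_mem_uIcc {a b s : ℝ} (hs : s ∈ Icc (0 : ℝ) 1) : a + (b - a) * s ∈ uIcc a b := by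
  rcases le_total a b with h | h
  · rw [uIcc_of_le h]
    constructor <;> nlinarith [hs.1, hs.2]
  · rw [uIcc_of_ge h]
    constructor <;> nlinarith [hs.1, hs.2]

theorem ac_comp_affine {f : ℝ → ℝ} {a b : ℝ} (hf : AbsolutelyContinuousOnInterval f a b) :
    AbsolutelyContinuousOnInterval (fun s => f (a + (b - a) * s)) 0 1 := by
  rcases eq_or_ne a b with rfl | hab
  · simpa using ac_const (f a) 0 1
  have hk : b - a ≠ 0 := sub_ne_zero.2 hab.symm
  refine ac_of_eq_integral (g := fun s => (b - a) * deriv f (a + (b - a) * s)) ?_ ?_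
  · have h1 := (hf.intervalIntegrable_deriv.comp_add_left (c := a)).comp_mul_left (c := b - a)
    have h2 := h1.const_mul (b - a)
    simpa [div_self hk] using h2
  · intro s hs
    rw [uIcc_of_le zero_le_one] at hs
    rw [intervalIntegral.integral_const_mul, intervalIntegral.mul_integral_comp_add_mul]
    simpa using ac_eq_integral hf (affine_mem_uIcc hs)

theorem ac_trans {f : ℝ → ℝ} {a b c : ℝ} (hab : a ≤ b) (hbc : b ≤ c)
    (h₁ : AbsolutelyContinuousOnInterval f a b) (h₂ : AbsolutelyContinuousOnInterval f b c) :
    AbsolutelyContinuousOnInterval f a c := by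
  refine ac_of_eq_integral (h₁.intervalIntegrable_deriv.trans h₂.intervalIntegrable_deriv) ?_
  intro s hs
  rw [uIcc_of_le (hab.trans hbc)] at hs
  rcases le_total s b with h | h
  · exact ac_eq_integral h₁ (by rw [uIcc_of_le hab]; exact ⟨hs.1, h⟩)
  · have hs' : s ∈ uIcc b c := by rw [uIcc_of_le hbc]; exact ⟨h, hs.2⟩
    have e1 := ac_eq_integral h₂ hs'
    have e2 := ac_eq_integral h₁ right_mem_uIcc
    rw [e1, e2, add_assoc, intervalIntegral.integral_add_adjacent_intervals
      h₁.intervalIntegrable_deriv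
      (h₂.mono (uIcc_subset_uIcc_left hs')).intervalIntegrable_deriv]

theorem ae_comp_affine {P : ℝ → Prop} {a k : ℝ} (hk : k ≠ 0) (h : ∀ᵐ s, P s) :
    ∀ᵐ s, P (a + k * s) := by
  have h1 : Measure.QuasiMeasurePreserving (fun s : ℝ => k * s) volume volume := by
    refine ⟨measurable_const_mul k, ?_⟩
    rw [Real.map_volume_mul_left hk]
    exact Measure.smul_absolutelyContinuous
  have h2 := (measurePreserving_add_left (volume : Measure ℝ) a).quasiMeasurePreserving
  exact (h2.comp h1).ae h

/-! ### Horizontal curves -/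

theorem mem_horizontalPlane {p : Heis} {v : ℝ × ℝ × ℝ} :
    v ∈ horizontalPlane p ↔ v.2.2 = 2 * p.y * v.1 - 2 * p.x * v.2.1 := by
  obtain ⟨a, b, c⟩ := v
  rw [horizontalPlane, Submodule.mem_span_pair]
  constructor
  · rintro ⟨α, β, h⟩
    simp only [fieldX, fieldY, Prod.smul_mk, smul_eq_mul, Prod.mk_add_mk, Prod.mk.injEq] at h
    obtain ⟨rfl, rfl, rfl⟩ := h
    ring
  · intro h
    refine ⟨a, b, ?_⟩
    simp only at h
    simp only [fieldX, fieldY, Prod.smul_mk, smul_eq_mul, Prod.mk_add_mk, Prod.mk.injEq, h]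
    refine ⟨by ring, by ring, by ring⟩

/-- The horizontal speed of a curve. -/
noncomputable def speed (γ : ℝ → Heis) (s : ℝ) : ℝ :=
  Real.sqrt (deriv (fun s => (γ s).x) s ^ 2 + deriv (fun s => (γ s).y) s ^ 2)

/-- Horizontal curves parametrized by the interval with endpoints `a` and `b`, which may come in
either order; the horizontality condition is written out in coordinates. -/
structure IsHorizontalOn (γ : ℝ → Heis) (a b : ℝ) : Prop where
  x : AbsolutelyContinuousOnInterval (fun s => (γ s).x) a b
  y : AbsolutelyContinuousOnInterval (fun s => (γ s).y) a b
  t : AbsolutelyContinuousOnInterval (fun s => (γ s).t) a b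
  deriv_t : ∀ᵐ s, s ∈ uIcc a b → deriv (fun s => (γ s).t) s =
    2 * (γ s).y * deriv (fun s => (γ s).x) s - 2 * (γ s).x * deriv (fun s => (γ s).y) s

theorem isHorizontalCurve_iff {γ : ℝ → Heis} :
    IsHorizontalCurve γ ↔ IsHorizontalOn γ 0 1 := by
  unfold IsHorizontalCurve
  simp only [mem_horizontalPlane]
  rw [ae_restrict_iff' measurableSet_Icc]
  constructor
  · rintro ⟨h1, h2, h3, h4⟩
    exact ⟨h1, h2, h3, by rwa [uIcc_of_le zero_le_one]⟩
  · rintro ⟨h1, h2, h3, h4⟩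
    exact ⟨h1, h2, h3, by rwa [uIcc_of_le zero_le_one] at h4⟩

theorem speed_nonneg (γ : ℝ → Heis) (s : ℝ) : 0 ≤ speed γ s := Real.sqrt_nonneg _

theorem IsHorizontalOn.mono {γ : ℝ → Heis} {a b c d : ℝ} (h : IsHorizontalOn γ a b)
    (hs : uIcc c d ⊆ uIcc a b) : IsHorizontalOn γ c d :=
  ⟨h.x.mono hs, h.y.mono hs, h.t.mono hs, h.deriv_t.mono fun _ H hm => H (hs hm)⟩

theorem speed_le (γ : ℝ → Heis) (s : ℝ) :
    speed γ s ≤ |deriv (fun s => (γ s).x) s| + |deriv (fun s => (γ s).y) s| := by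
  refine Real.sqrt_le_iff.2 ⟨by positivity, ?_⟩
  nlinarith [sq_abs (deriv (fun s => (γ s).x) s), sq_abs (deriv (fun s => (γ s).y) s),
    abs_nonneg (deriv (fun s => (γ s).x) s), abs_nonneg (deriv (fun s => (γ s).y) s),
    mul_nonneg (abs_nonneg (deriv (fun s => (γ s).x) s))
      (abs_nonneg (deriv (fun s => (γ s).y) s))]

theorem abs_deriv_x_le_speed (γ : ℝ → Heis) (s : ℝ) :
    |deriv (fun s => (γ s).x) s| ≤ speed γ s := by
  rw [← Real.sqrt_sq_eq_abs]
  exact Real.sqrt_le_sqrt (by nlinarith [sq_nonneg (deriv (fun s => (γ s).y) s)])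

theorem abs_deriv_y_le_speed (γ : ℝ → Heis) (s : ℝ) :
    |deriv (fun s => (γ s).y) s| ≤ speed γ s := by
  rw [← Real.sqrt_sq_eq_abs]
  exact Real.sqrt_le_sqrt (by nlinarith [sq_nonneg (deriv (fun s => (γ s).x) s)])

theorem measurable_speed (γ : ℝ → Heis) : Measurable (speed γ) :=
  (((measurable_deriv _).pow_const 2).add ((measurable_deriv _).pow_const 2)).sqrt

theorem IsHorizontalOn.intervalIntegrable_speed {γ : ℝ → Heis} {a b : ℝ}
    (h : IsHorizontalOn γ a b) : IntervalIntegrable (speed γ) volume a b := by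
  have h1 := h.x.intervalIntegrable_deriv.abs.add h.y.intervalIntegrable_deriv.abs
  refine h1.mono_fun (measurable_speed γ).aestronglyMeasurable (ae_of_all _ fun s => ?_)
  beta_reduce
  rw [Real.norm_of_nonneg (speed_nonneg γ s)]
  exact (speed_le γ s).trans (le_abs_self _)

theorem subRiemDist_le_horizontalLength {γ : ℝ → Heis} (h : IsHorizontalCurve γ) :
    subRiemDist (γ 0) (γ 1) ≤ horizontalLength γ := by
  refine csInf_le ⟨0, ?_⟩ ⟨γ, h, rfl, rfl, rfl⟩
  rintro L ⟨γ', -, -, -, rfl⟩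
  exact intervalIntegral.integral_nonneg zero_le_one fun s _ => Real.sqrt_nonneg _

theorem subRiemDist_nonneg (p q : Heis) : 0 ≤ subRiemDist p q := by
  refine Real.sInf_nonneg ?_
  rintro L ⟨γ', -, -, -, rfl⟩
  exact intervalIntegral.integral_nonneg zero_le_one fun s _ => Real.sqrt_nonneg _

theorem speed_comp_affine (γ : ℝ → Heis) (a k s : ℝ) :
    speed (fun s => γ (a + k * s)) s = |k| * speed γ (a + k * s) := by
  have h1 := deriv_comp_affine (fun s => (γ s).x) a k s
  have h2 := deriv_comp_affine (fun s => (γ s).y) a k s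
  unfold speed
  rw [h1, h2, ← Real.sqrt_sq_eq_abs, ← Real.sqrt_mul (sq_nonneg k)]
  congr 1
  ring

theorem IsHorizontalOn.comp_affine {γ : ℝ → Heis} {a b : ℝ} (hab : a ≠ b)
    (h : IsHorizontalOn γ a b) : IsHorizontalOn (fun s => γ (a + (b - a) * s)) 0 1 := by
  have hx := ac_comp_affine h.x
  have hy := ac_comp_affine h.y
  have ht := ac_comp_affine h.t
  refine ⟨hx, hy, ht, ?_⟩
  filter_upwards [ae_comp_affine (a := a) (sub_ne_zero.2 hab.symm) h.deriv_t] with s hs hm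
  rw [uIcc_of_le zero_le_one] at hm
  have h1 := deriv_comp_affine (fun s => (γ s).x) a (b - a) s
  have h2 := deriv_comp_affine (fun s => (γ s).y) a (b - a) s
  have h3 := deriv_comp_affine (fun s => (γ s).t) a (b - a) s
  rw [h1, h2, h3, hs (affine_mem_uIcc hm)]
  ring

theorem subRiemDist_self (p : Heis) : subRiemDist p p = 0 := by
  refine le_antisymm ?_ (subRiemDist_nonneg p p)
  have h : IsHorizontalCurve fun _ => p := isHorizontalCurve_iff.2
    ⟨ac_const _ _ _, ac_const _ _ _, ac_const _ _ _, ae_of_all _ fun s _ => by simp⟩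
  simpa [horizontalLength] using subRiemDist_le_horizontalLength h

/-- The curve may be traversed in either direction, which makes the distance symmetric. -/
theorem IsHorizontalOn.subRiemDist_le {γ : ℝ → Heis} {a b : ℝ}
    (h : IsHorizontalOn γ a b) : subRiemDist (γ a) (γ b) ≤ |∫ s in a..b, speed γ s| := by
  rcases eq_or_ne a b with rfl | hab
  · simp [subRiemDist_self]
  have h1 := subRiemDist_le_horizontalLength (isHorizontalCurve_iff.2 (h.comp_affine hab))
  have h2 : horizontalLength (fun s => γ (a + (b - a) * s)) = |∫ s in a..b, speed γ s| := by
    change ∫ s in (0 : ℝ)..1, speed (fun s => γ (a + (b - a) * s)) s = _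
    simp_rw [speed_comp_affine]
    rw [intervalIntegral.integral_const_mul, ← abs_of_nonneg
      (intervalIntegral.integral_nonneg zero_le_one fun s _ => speed_nonneg γ (a + (b - a) * s)),
      ← abs_mul, intervalIntegral.mul_integral_comp_add_mul]
    simp
  rw [h2] at h1
  simpa using h1

/-- Two horizontal curves can be traversed one after the other. -/
theorem subRiemDist_le_add_of_isHorizontalOn {γ γ' : ℝ → Heis} (h : IsHorizontalOn γ 0 1)
    (h' : IsHorizontalOn γ' 0 1) (e : γ 1 = γ' 0) :
    subRiemDist (γ 0) (γ' 1) ≤ (∫ s in (0 : ℝ)..1, speed γ s) + ∫ s in (0 : ℝ)..1, speed γ' s := by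
  -- `γ` on `[0, 1]`, followed by the copy of `γ'` on `[1, 2]`
  set σ : ℝ → Heis := fun s => if s ≤ 1 then γ s else γ' (s - 1) with hσ
  have sub_eq : ∀ s : ℝ, s - 1 = -1 + 1 * s := fun s => by ring
  have eq1 : EqOn γ σ (uIcc 0 1) := by
    intro s hs
    rw [uIcc_of_le zero_le_one] at hs
    simp [hσ, hs.2]
  have eq2 : EqOn (fun s => γ' (s - 1)) σ (uIcc 1 2) := by
    intro s hs
    rw [uIcc_of_le one_le_two] at hs
    rcases eq_or_lt_of_le hs.1 with rfl | h1
    · simp [hσ, e]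
    · simp [hσ, not_le.2 h1]
  have d1 : ∀ (F : Heis → ℝ) (s : ℝ), s < 1 →
      deriv (fun s => F (σ s)) s = deriv (fun s => F (γ s)) s := by
    intro F s hs
    refine Filter.EventuallyEq.deriv_eq ?_
    filter_upwards [Iio_mem_nhds hs] with v hv
    simp [hσ, (mem_Iio.1 hv).le]
  have d2 : ∀ (F : Heis → ℝ) (s : ℝ), 1 < s →
      deriv (fun s => F (σ s)) s = deriv (fun s => F (γ' s)) (s - 1) := by
    intro F s hs
    rw [← deriv_comp_sub_const]
    refine Filter.EventuallyEq.deriv_eq ?_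
    filter_upwards [Ioi_mem_nhds hs] with v hv
    simp [hσ, not_le.2 (mem_Ioi.1 hv)]
  have ac2 : ∀ F : Heis → ℝ, AbsolutelyContinuousOnInterval (fun s => F (γ' s)) 0 1 →
      AbsolutelyContinuousOnInterval (fun s => F (γ' (s - 1))) 1 2 := by
    intro F hF
    refine ac_of_eq_integral (g := fun s => deriv (fun s => F (γ' s)) (s - 1)) ?_ ?_
    · have := hF.intervalIntegrable_deriv.comp_sub_right (c := 1)
      norm_num at this
      exact this
    · intro s hs
      rw [uIcc_of_le one_le_two] at hs
      rw [intervalIntegral.integral_comp_sub_right (fun s => deriv (fun s => F (γ' s)) s) 1]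
      have := ac_eq_integral hF (s := s - 1)
        (by rw [uIcc_of_le zero_le_one]; exact ⟨by linarith [hs.1], by linarith [hs.2]⟩)
      simpa using this
  have acσ : ∀ F : Heis → ℝ, AbsolutelyContinuousOnInterval (fun s => F (γ s)) 0 1 →
      AbsolutelyContinuousOnInterval (fun s => F (γ' s)) 0 1 →
      AbsolutelyContinuousOnInterval (fun s => F (σ s)) 0 2 := by
    intro F hF hF'
    refine ac_trans zero_le_one one_le_two (ac_congr hF fun s hs => ?_)
      (ac_congr (ac2 F hF') fun s hs => ?_)
    · exact congrArg F (eq1 hs)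
    · exact congrArg F (eq2 hs)
  have hor : IsHorizontalOn σ 0 2 := by
    refine ⟨acσ x h.x h'.x, acσ y h.y h'.y, acσ t h.t h'.t, ?_⟩
    have hae := ae_comp_affine (a := -1) one_ne_zero h'.deriv_t
    have hne : ∀ᵐ s : ℝ, s ≠ 1 := by simp [ae_iff]
    filter_upwards [h.deriv_t, hae, hne] with s hs1 hs2 hs3 hm
    rw [uIcc_of_le zero_le_two] at hm
    rw [← sub_eq] at hs2
    rcases lt_or_gt_of_ne hs3 with hlt | hgt
    · rw [d1 x s hlt, d1 y s hlt, d1 t s hlt,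
        hs1 (by rw [uIcc_of_le zero_le_one]; exact ⟨hm.1, hlt.le⟩)]
      simp [hσ, hlt.le]
    · rw [d2 x s hgt, d2 y s hgt, d2 t s hgt,
        hs2 (by rw [uIcc_of_le zero_le_one]; exact ⟨by linarith, by linarith [hm.2]⟩)]
      simp [hσ, not_le.2 hgt]
  have key := hor.subRiemDist_le
  have s1 : IsHorizontalOn σ 0 1 := hor.mono (by
    rw [uIcc_of_le zero_le_one, uIcc_of_le zero_le_two]
    exact Icc_subset_Icc_right one_le_two)
  have s2 : IsHorizontalOn σ 1 2 := hor.mono (by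
    rw [uIcc_of_le one_le_two, uIcc_of_le zero_le_two]
    exact Icc_subset_Icc_left zero_le_one)
  rw [abs_of_nonneg (intervalIntegral.integral_nonneg zero_le_two fun s _ => speed_nonneg _ _),
    ← intervalIntegral.integral_add_adjacent_intervals s1.intervalIntegrable_speed
      s2.intervalIntegrable_speed] at key
  have i1 : ∫ s in (0 : ℝ)..1, speed σ s = ∫ s in (0 : ℝ)..1, speed γ s := by
    refine intervalIntegral.integral_congr_ae ?_
    have hne : ∀ᵐ s : ℝ, s ≠ 1 := by simp [ae_iff]
    filter_upwards [hne] with s hs hm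
    rw [uIoc_of_le zero_le_one] at hm
    unfold speed
    rw [d1 x s (lt_of_le_of_ne hm.2 hs), d1 y s (lt_of_le_of_ne hm.2 hs)]
  have i2 : ∫ s in (1 : ℝ)..2, speed σ s = ∫ s in (0 : ℝ)..1, speed γ' s := by
    have : ∫ s in (1 : ℝ)..2, speed σ s = ∫ s in (1 : ℝ)..2, speed γ' (s - 1) := by
      refine intervalIntegral.integral_congr_ae (ae_of_all _ fun s hm => ?_)
      rw [uIoc_of_le one_le_two] at hm
      unfold speed
      rw [d2 x s hm.1, d2 y s hm.1]
    rw [this, intervalIntegral.integral_comp_sub_right (fun s => speed γ' s) 1]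
    norm_num
  rw [i1, i2] at key
  have e0 : σ 0 = γ 0 := by simp [hσ]
  have e2 : σ 2 = γ' 1 := by norm_num [hσ]
  rwa [e0, e2] at key

/-! ### The Korányi norm -/

theorem koranyiNorm_nonneg (p : Heis) : 0 ≤ koranyiNorm p :=
  Real.rpow_nonneg (by positivity) _

theorem koranyiNorm_pow_four (p : Heis) :
    koranyiNorm p ^ 4 = (p.x ^ 2 + p.y ^ 2) ^ 2 + p.t ^ 2 := by
  rw [koranyiNorm, ← Real.rpow_natCast, ← Real.rpow_mul (by positivity)]
  norm_num

theorem koranyiNorm_le_of {p : Heis} {c : ℝ} (hc : 0 ≤ c)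
    (h : (p.x ^ 2 + p.y ^ 2) ^ 2 + p.t ^ 2 ≤ c ^ 4) : koranyiNorm p ≤ c := by
  rw [← koranyiNorm_pow_four] at h
  exact le_of_pow_le_pow_left₀ (by norm_num) hc h

theorem sq_add_sq_le_koranyiNorm_sq (p : Heis) : p.x ^ 2 + p.y ^ 2 ≤ koranyiNorm p ^ 2 := by
  refine le_of_pow_le_pow_left₀ two_ne_zero (sq_nonneg _) ?_
  rw [← pow_mul, koranyiNorm_pow_four]
  nlinarith [sq_nonneg p.t]

theorem abs_x_le_koranyiNorm (p : Heis) : |p.x| ≤ koranyiNorm p :=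
  abs_le_of_sq_le_sq (by nlinarith [sq_add_sq_le_koranyiNorm_sq p, sq_nonneg p.y])
    (koranyiNorm_nonneg p)

theorem abs_y_le_koranyiNorm (p : Heis) : |p.y| ≤ koranyiNorm p :=
  abs_le_of_sq_le_sq (by nlinarith [sq_add_sq_le_koranyiNorm_sq p, sq_nonneg p.x])
    (koranyiNorm_nonneg p)

theorem abs_t_le_koranyiNorm_sq (p : Heis) : |p.t| ≤ koranyiNorm p ^ 2 := by
  refine le_of_pow_le_pow_left₀ two_ne_zero (sq_nonneg _) ?_
  rw [← pow_mul, koranyiNorm_pow_four, sq_abs]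
  nlinarith [sq_nonneg (p.x ^ 2 + p.y ^ 2)]

theorem koranyiNorm_inv (p : Heis) : koranyiNorm p⁻¹ = koranyiNorm p := by
  simp [koranyiNorm]

theorem koranyiDist_comm (p q : Heis) : koranyiDist p q = koranyiDist q p := by
  rw [koranyiDist, koranyiDist, ← koranyiNorm_inv, mul_inv_rev, inv_inv]

theorem koranyiDist_mul_left (g p q : Heis) : koranyiDist (g * p) (g * q) = koranyiDist p q := by
  rw [koranyiDist, koranyiDist]
  congr 1
  group

theorem koranyiDist_nonneg (p q : Heis) : 0 ≤ koranyiDist p q := koranyiNorm_nonneg _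

/-- The automorphic dilation `(x, y, t) ↦ (R x, R y, R² t)`. -/
def dil (R : ℝ) (p : Heis) : Heis := mk (R * p.x) (R * p.y) (R ^ 2 * p.t)

@[simp] theorem dil_x (R : ℝ) (p : Heis) : (dil R p).x = R * p.x := rfl
@[simp] theorem dil_y (R : ℝ) (p : Heis) : (dil R p).y = R * p.y := rfl
@[simp] theorem dil_t (R : ℝ) (p : Heis) : (dil R p).t = R ^ 2 * p.t := rfl

theorem dil_mul (R : ℝ) (p q : Heis) : dil R (p * q) = dil R p * dil R q :=
  ext_coord (by simp; ring) (by simp; ring) (by simp; ring)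

theorem dil_inv (R : ℝ) (p : Heis) : dil R p⁻¹ = (dil R p)⁻¹ :=
  ext_coord (by simp) (by simp) (by simp)

theorem dil_one (R : ℝ) : dil R 1 = 1 :=
  ext_coord (by simp) (by simp) (by simp)

theorem dil_dil (R S : ℝ) (p : Heis) : dil R (dil S p) = dil (R * S) p :=
  ext_coord (by simp; ring) (by simp; ring) (by simp; ring)

theorem one_dil (p : Heis) : dil 1 p = p :=
  ext_coord (by simp) (by simp) (by simp)

theorem koranyiNorm_dil {R : ℝ} (hR : 0 ≤ R) (p : Heis) :
    koranyiNorm (dil R p) = R * koranyiNorm p := by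
  refine (pow_left_inj₀ (koranyiNorm_nonneg _) (mul_nonneg hR (koranyiNorm_nonneg _))
    (by norm_num : (4 : ℕ) ≠ 0)).1 ?_
  rw [mul_pow, koranyiNorm_pow_four, koranyiNorm_pow_four]
  simp
  ring

theorem koranyiDist_dil {R : ℝ} (hR : 0 ≤ R) (p q : Heis) :
    koranyiDist (dil R p) (dil R q) = R * koranyiDist p q := by
  rw [koranyiDist, koranyiDist, ← koranyiNorm_dil hR, dil_mul, dil_inv]

/-! ### The sub-Riemannian distance -/

theorem IsHorizontalOn.mul_left {γ : ℝ → Heis} {a b : ℝ} (g : Heis) (h : IsHorizontalOn γ a b) :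
    IsHorizontalOn (fun s => g * γ s) a b := by
  have ht := (((ac_const g.t a b).add h.t).sub (h.y.const_mul (2 * g.x))).add
    (h.x.const_mul (2 * g.y))
  refine ⟨(ac_const g.x a b).add h.x, (ac_const g.y a b).add h.y,
    ac_congr ht fun s _ => by simp; ring, ?_⟩
  filter_upwards [h.x.ae_differentiableAt, h.y.ae_differentiableAt, h.t.ae_differentiableAt,
    h.deriv_t] with s dx dy dt hs hm
  have Dx := (dx hm).hasDerivAt
  have Dy := (dy hm).hasDerivAt
  have Dt := (dt hm).hasDerivAt
  have e1 : deriv (fun s => (g * γ s).x) s = deriv (fun s => (γ s).x) s :=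
    (Dx.const_add g.x).deriv
  have e2 : deriv (fun s => (g * γ s).y) s = deriv (fun s => (γ s).y) s :=
    (Dy.const_add g.y).deriv
  have e3 := (((Dt.const_add g.t).sub (Dy.const_mul (2 * g.x))).add
    ((Dx.const_mul 2).mul_const g.y)).deriv
  rw [e1, e2]
  refine e3.trans ?_
  rw [hs hm]
  simp only [mul_x, mul_y]
  ring

theorem speed_mul_left (g : Heis) (γ : ℝ → Heis) (s : ℝ) :
    speed (fun s => g * γ s) s = speed γ s := by
  simp only [speed, mul_x, mul_y, deriv_const_add]

theorem IsHorizontalOn.dil {γ : ℝ → Heis} {a b : ℝ} (R : ℝ) (h : IsHorizontalOn γ a b) :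
    IsHorizontalOn (fun s => Heis.dil R (γ s)) a b := by
  refine ⟨h.x.const_mul R, h.y.const_mul R, h.t.const_mul (R ^ 2), ?_⟩
  filter_upwards [h.deriv_t] with s hs hm
  simp only [dil_x, dil_y, dil_t, deriv_const_mul_field]
  rw [hs hm]
  ring

theorem speed_dil {R : ℝ} (hR : 0 ≤ R) (γ : ℝ → Heis) (s : ℝ) :
    speed (fun s => dil R (γ s)) s = R * speed γ s := by
  simp only [speed, dil_x, dil_y, deriv_const_mul_field]
  conv_rhs => rw [← Real.sqrt_sq hR, ← Real.sqrt_mul (sq_nonneg R)]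
  congr 1
  ring

/-- A loop of zero mean in both coordinates is added to the segment from the origin to the
projection of `p`. Having zero mean, it does not interact with the segment, so that its area,
which is proportional to the product of its two amplitudes, is the only contribution to the last
coordinate. -/
theorem exists_isHorizontalOn_one (p : Heis) : ∃ γ : ℝ → Heis,
    IsHorizontalOn γ 0 1 ∧ γ 0 = 1 ∧ γ 1 = p ∧
      ∫ s in (0 : ℝ)..1, speed γ s ≤ 300 * koranyiNorm p := by
  obtain ⟨α, β, hα, hβ, hαβ⟩ : ∃ α β : ℝ, |α| ≤ 10 * koranyiNorm p ∧ |β| ≤ 10 * koranyiNorm p ∧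
      α * β * (2 / 175) = p.t := by
    have hN := koranyiNorm_nonneg p
    have ht := abs_t_le_koranyiNorm_sq p
    rcases eq_or_lt_of_le hN with h0 | h0
    · refine ⟨0, 0, by simpa using hN, by simpa using hN, ?_⟩
      rw [← h0] at ht
      have : |p.t| = 0 := le_antisymm (by simpa using ht) (abs_nonneg _)
      simpa using (abs_eq_zero.1 this).symm
    · refine ⟨10 * koranyiNorm p, p.t * (35 / 4) / koranyiNorm p, ?_, ?_, ?_⟩
      · rw [abs_of_nonneg (by positivity)]
      · rw [abs_div, abs_mul, abs_of_pos h0, abs_of_pos (by norm_num : (0 : ℝ) < 35 / 4),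
          div_le_iff₀ h0]
        nlinarith
      · field_simp
        ring
  set X : ℝ → ℝ := fun s => s * p.x + α * (s - 3 * s ^ 2 + 2 * s ^ 3) with hX
  set Y : ℝ → ℝ := fun s => s * p.y + β * (s / 5 - 6 / 5 * s ^ 2 + 2 * s ^ 3 - s ^ 4) with hY
  set T : ℝ → ℝ := fun s => α * p.y * (-2 * s ^ 3 + 2 * s ^ 4) +
    β * p.x * (2 * (2 / 5 * s ^ 3 - s ^ 4 + 3 / 5 * s ^ 5)) +
    α * β * (2 * (s ^ 3 / 5 - 4 / 5 * s ^ 4 + 33 / 25 * s ^ 5 - s ^ 6 + 2 / 7 * s ^ 7)) with hT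
  have DX : ∀ s, HasDerivAt X (p.x + α * (1 - 6 * s + 6 * s ^ 2)) s := by
    intro s
    have h1 := hasDerivAt_id s
    have := (h1.mul_const p.x).add
      (((h1.sub ((h1.pow 2).const_mul 3)).add ((h1.pow 3).const_mul 2)).const_mul α)
    refine this.congr_deriv ?_
    simp only [id, Nat.reduceSub, Nat.cast_ofNat]
    ring
  have DY : ∀ s, HasDerivAt Y (p.y + β * (1 / 5 - 12 / 5 * s + 6 * s ^ 2 - 4 * s ^ 3)) s := by
    intro s
    have h1 := hasDerivAt_id s
    have := (h1.mul_const p.y).add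
      (((((h1.div_const 5).sub ((h1.pow 2).const_mul (6 / 5))).add
        ((h1.pow 3).const_mul 2)).sub (h1.pow 4)).const_mul β)
    refine this.congr_deriv ?_
    simp only [id, Nat.reduceSub, Nat.cast_ofNat]
    ring
  have DT : ∀ s, HasDerivAt T (2 * Y s * (p.x + α * (1 - 6 * s + 6 * s ^ 2)) -
      2 * X s * (p.y + β * (1 / 5 - 12 / 5 * s + 6 * s ^ 2 - 4 * s ^ 3))) s := by
    intro s
    have h1 := hasDerivAt_id s
    have := ((((h1.pow 3).const_mul (-2)).add ((h1.pow 4).const_mul 2)).const_mul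
      (α * p.y)).add ((((((h1.pow 3).const_mul (2 / 5)).sub (h1.pow 4)).add
        ((h1.pow 5).const_mul (3 / 5))).const_mul 2).const_mul (β * p.x)) |>.add
      (((((((h1.pow 3).div_const 5).sub ((h1.pow 4).const_mul (4 / 5))).add
        ((h1.pow 5).const_mul (33 / 25))).sub (h1.pow 6)).add
        ((h1.pow 7).const_mul (2 / 7))).const_mul 2 |>.const_mul (α * β))
    refine this.congr_deriv ?_
    simp [hX, hY]
    ring
  have acX : AbsolutelyContinuousOnInterval X 0 1 :=
    ContDiffOn.absolutelyContinuousOnInterval (ContDiff.contDiffOn (by rw [hX]; fun_prop))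
  have acY : AbsolutelyContinuousOnInterval Y 0 1 :=
    ContDiffOn.absolutelyContinuousOnInterval (ContDiff.contDiffOn (by rw [hY]; fun_prop))
  have acT : AbsolutelyContinuousOnInterval T 0 1 :=
    ContDiffOn.absolutelyContinuousOnInterval (ContDiff.contDiffOn (by rw [hT]; fun_prop))
  have hor : IsHorizontalOn (fun s => mk (X s) (Y s) (T s)) 0 1 := by
    refine ⟨acX, acY, acT, ae_of_all _ fun s _ => ?_⟩
    simp only [x_mk, y_mk, t_mk]
    rw [(DX s).deriv, (DY s).deriv, (DT s).deriv]
  refine ⟨_, hor, ext_coord (by simp [hX]) (by simp [hY]) (by simp [hT]),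
    ext_coord (by norm_num [hX]) (by norm_num [hY]) ?_, ?_⟩
  · simp only [t_mk, hT]
    rw [← hαβ]
    ring
  · have hb : ∀ s ∈ Icc (0 : ℝ) 1, speed (fun s => mk (X s) (Y s) (T s)) s ≤
        300 * koranyiNorm p := by
      intro s hs
      refine (speed_le _ s).trans ?_
      simp only [x_mk, y_mk]
      rw [(DX s).deriv, (DY s).deriv]
      have hs2 : s ^ 2 ≤ 1 := by nlinarith [hs.1, hs.2]
      have hs3 : s ^ 3 ≤ 1 := pow_le_one₀ hs.1 hs.2
      have hs3' : 0 ≤ s ^ 3 := pow_nonneg hs.1 3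
      have b1 : |1 - 6 * s + 6 * s ^ 2| ≤ 13 := by
        rw [abs_le]; constructor <;> nlinarith [hs.1, hs.2, sq_nonneg s]
      have b2 : |1 / 5 - 12 / 5 * s + 6 * s ^ 2 - 4 * s ^ 3| ≤ 13 := by
        rw [abs_le]; constructor <;> nlinarith [hs.1, hs.2, sq_nonneg s]
      have c1 := (abs_add_le p.x (α * (1 - 6 * s + 6 * s ^ 2)))
      have c2 := (abs_add_le p.y (β * (1 / 5 - 12 / 5 * s + 6 * s ^ 2 - 4 * s ^ 3)))
      rw [abs_mul] at c1 c2
      have d1 := mul_le_mul hα b1 (abs_nonneg _) (by linarith [koranyiNorm_nonneg p])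
      have d2 := mul_le_mul hβ b2 (abs_nonneg _) (by linarith [koranyiNorm_nonneg p])
      linarith [abs_x_le_koranyiNorm p, abs_y_le_koranyiNorm p, koranyiNorm_nonneg p]
    refine (intervalIntegral.integral_mono_on zero_le_one hor.intervalIntegrable_speed
      intervalIntegrable_const hb).trans ?_
    simp

theorem exists_isHorizontalOn (p q : Heis) : ∃ γ : ℝ → Heis,
    IsHorizontalOn γ 0 1 ∧ γ 0 = p ∧ γ 1 = q ∧
      ∫ s in (0 : ℝ)..1, speed γ s ≤ 300 * koranyiDist p q := by
  obtain ⟨γ, h, h0, h1, h2⟩ := exists_isHorizontalOn_one (p⁻¹ * q)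
  refine ⟨_, h.mul_left p, by simp [h0], by simp [h1], ?_⟩
  simp_rw [speed_mul_left]
  rwa [koranyiDist_comm]

theorem exists_isHorizontalOn_lt (p q : Heis) {c : ℝ} (hc : subRiemDist p q < c) :
    ∃ γ : ℝ → Heis, IsHorizontalOn γ 0 1 ∧ γ 0 = p ∧ γ 1 = q ∧
      ∫ s in (0 : ℝ)..1, speed γ s < c := by
  obtain ⟨γ, h, h0, h1, -⟩ := exists_isHorizontalOn p q
  obtain ⟨L, ⟨γ', h', h0', h1', rfl⟩, hL⟩ := exists_lt_of_csInf_lt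
    (⟨_, γ, isHorizontalCurve_iff.2 h, h0, h1, rfl⟩ : Set.Nonempty {L : ℝ | ∃ γ : ℝ → Heis,
      IsHorizontalCurve γ ∧ γ 0 = p ∧ γ 1 = q ∧ L = horizontalLength γ}) hc
  exact ⟨γ', isHorizontalCurve_iff.1 h', h0', h1', hL⟩

theorem IsHorizontalOn.subRiemDist_le_integral {γ : ℝ → Heis} {a b : ℝ} (hab : a ≤ b)
    (h : IsHorizontalOn γ a b) : subRiemDist (γ a) (γ b) ≤ ∫ s in a..b, speed γ s :=
  h.subRiemDist_le.trans_eq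
    (abs_of_nonneg (intervalIntegral.integral_nonneg hab fun _ _ => speed_nonneg _ _))

theorem subRiemDist_le_koranyiDist (p q : Heis) : subRiemDist p q ≤ 300 * koranyiDist p q := by
  obtain ⟨γ, h, rfl, rfl, hL⟩ := exists_isHorizontalOn p q
  exact (h.subRiemDist_le_integral zero_le_one).trans hL

theorem subRiemDist_comm (p q : Heis) : subRiemDist p q = subRiemDist q p := by
  have key : ∀ p q : Heis, subRiemDist p q ≤ subRiemDist q p := by
    intro p q
    refine le_of_forall_gt_imp_ge_of_dense fun c hc => ?_
    obtain ⟨γ, h, rfl, rfl, hL⟩ := exists_isHorizontalOn_lt q p hc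
    have h' : IsHorizontalOn γ 1 0 := h.mono (by rw [uIcc_comm])
    refine h'.subRiemDist_le.trans ?_
    rw [intervalIntegral.integral_symm, abs_neg, abs_of_nonneg
      (intervalIntegral.integral_nonneg zero_le_one fun _ _ => speed_nonneg _ _)]
    exact hL.le
  exact le_antisymm (key p q) (key q p)

theorem subRiemDist_triangle (p q r : Heis) :
    subRiemDist p r ≤ subRiemDist p q + subRiemDist q r := by
  refine le_of_forall_pos_le_add fun ε hε => ?_
  obtain ⟨γ, h, rfl, h1, hL⟩ := exists_isHorizontalOn_lt p q
    (lt_add_of_pos_right (subRiemDist p q) (half_pos hε))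
  obtain ⟨γ', h', h0', rfl, hL'⟩ := exists_isHorizontalOn_lt q r
    (lt_add_of_pos_right (subRiemDist q r) (half_pos hε))
  have := subRiemDist_le_add_of_isHorizontalOn h h' (h1.trans h0'.symm)
  linarith

theorem subRiemDist_mul_left (g p q : Heis) :
    subRiemDist (g * p) (g * q) = subRiemDist p q := by
  have key : ∀ g p q : Heis, subRiemDist (g * p) (g * q) ≤ subRiemDist p q := by
    intro g p q
    refine le_of_forall_gt_imp_ge_of_dense fun c hc => ?_
    obtain ⟨γ, h, rfl, rfl, hL⟩ := exists_isHorizontalOn_lt p q hc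
    refine ((h.mul_left g).subRiemDist_le_integral zero_le_one).trans ?_
    simp_rw [speed_mul_left]
    exact hL.le
  refine le_antisymm (key g p q) ?_
  simpa using key g⁻¹ (g * p) (g * q)

theorem subRiemDist_dil {R : ℝ} (hR : 0 < R) (p q : Heis) :
    subRiemDist (dil R p) (dil R q) = R * subRiemDist p q := by
  have key : ∀ R : ℝ, 0 < R → ∀ p q : Heis,
      subRiemDist (dil R p) (dil R q) ≤ R * subRiemDist p q := by
    intro R hR p q
    rw [← div_le_iff₀' hR]
    refine le_of_forall_gt_imp_ge_of_dense fun c hc => ?_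
    obtain ⟨γ, h, rfl, rfl, hL⟩ := exists_isHorizontalOn_lt p q hc
    rw [div_le_iff₀' hR]
    refine ((h.dil R).subRiemDist_le_integral zero_le_one).trans ?_
    simp_rw [speed_dil hR.le]
    rw [intervalIntegral.integral_const_mul]
    exact mul_le_mul_of_nonneg_left hL.le hR.le
  refine le_antisymm (key R hR p q) ?_
  have := key R⁻¹ (inv_pos.2 hR) (dil R p) (dil R q)
  rw [dil_dil, dil_dil, inv_mul_cancel₀ hR.ne', one_dil, one_dil, ← div_eq_inv_mul,
    le_div_iff₀' hR] at this
  exact this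

/-- The plane coordinates of a horizontal curve of length `L` from the origin stay below `L`;
hence the last coordinate is `O(L²)`. -/
theorem koranyiNorm_le_of_isHorizontalOn {γ : ℝ → Heis} (h : IsHorizontalOn γ 0 1)
    (h0 : γ 0 = 1) : koranyiNorm (γ 1) ≤ 3 * ∫ s in (0 : ℝ)..1, speed γ s := by
  set L := ∫ s in (0 : ℝ)..1, speed γ s with hL
  have hint := h.intervalIntegrable_speed
  have hL0 : 0 ≤ L := intervalIntegral.integral_nonneg zero_le_one fun _ _ => speed_nonneg _ _
  have bound : ∀ F : Heis → ℝ, F 1 = 0 →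
      AbsolutelyContinuousOnInterval (fun s => F (γ s)) 0 1 →
      (∀ s, |deriv (fun s => F (γ s)) s| ≤ speed γ s) →
      ∀ s ∈ Icc (0 : ℝ) 1, |F (γ s)| ≤ L := by
    intro F hF hac hle s hs
    have hs' : s ∈ uIcc (0 : ℝ) 1 := by rwa [uIcc_of_le zero_le_one]
    have e := ac_eq_integral hac hs'
    rw [h0, hF, zero_add] at e
    rw [e, ← Real.norm_eq_abs]
    have hi : IntervalIntegrable (speed γ) volume 0 s :=
      hint.mono_set (uIcc_subset_uIcc_left hs')
    refine (intervalIntegral.norm_integral_le_of_norm_le hs.1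
      (ae_of_all _ fun v _ => hle v) hi).trans ?_
    rw [hL]
    exact intervalIntegral.integral_mono_interval le_rfl hs.1 hs.2
      (ae_of_all _ fun v => speed_nonneg γ v) hint
  have bx := bound x rfl h.x (abs_deriv_x_le_speed γ)
  have by' := bound y rfl h.y (abs_deriv_y_le_speed γ)
  have bt : |(γ 1).t| ≤ 4 * L * L := by
    have e := ac_eq_integral h.t right_mem_uIcc
    rw [h0, one_t, zero_add] at e
    rw [e, hL, ← intervalIntegral.integral_const_mul, ← Real.norm_eq_abs]
    refine intervalIntegral.norm_integral_le_of_norm_le zero_le_one ?_ (hint.const_mul _)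
    filter_upwards [h.deriv_t] with s hs hm
    have hm' : s ∈ Icc (0 : ℝ) 1 := ⟨hm.1.le, hm.2⟩
    rw [hs (by rwa [uIcc_of_le zero_le_one]), Real.norm_eq_abs, ← hL]
    have e1 := abs_sub (2 * (γ s).y * deriv (fun s => (γ s).x) s)
      (2 * (γ s).x * deriv (fun s => (γ s).y) s)
    simp only [abs_mul, abs_two] at e1
    have e2 := mul_le_mul (by' s hm') (abs_deriv_x_le_speed γ s) (abs_nonneg _) hL0
    have e3 := mul_le_mul (bx s hm') (abs_deriv_y_le_speed γ s) (abs_nonneg _) hL0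
    nlinarith
  have hx := bx 1 ⟨zero_le_one, le_rfl⟩
  have hy := by' 1 ⟨zero_le_one, le_rfl⟩
  have hx2 : (γ 1).x ^ 2 ≤ L ^ 2 := sq_le_sq' (by linarith [abs_le.1 hx]) (abs_le.1 hx).2
  have hy2 : (γ 1).y ^ 2 ≤ L ^ 2 := sq_le_sq' (by linarith [abs_le.1 hy]) (abs_le.1 hy).2
  have ht2 : (γ 1).t ^ 2 ≤ (4 * L * L) ^ 2 := sq_le_sq' (by linarith [abs_le.1 bt]) (abs_le.1 bt).2
  refine koranyiNorm_le_of (by positivity) ?_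
  have : ((γ 1).x ^ 2 + (γ 1).y ^ 2) ^ 2 ≤ (2 * L ^ 2) ^ 2 :=
    pow_le_pow_left₀ (by positivity) (by linarith) 2
  nlinarith [pow_nonneg hL0 4]

theorem koranyiDist_le_subRiemDist (p q : Heis) : koranyiDist p q ≤ 3 * subRiemDist p q := by
  rw [← div_le_iff₀' (by norm_num : (0 : ℝ) < 3)]
  refine le_of_forall_gt_imp_ge_of_dense fun c hc => ?_
  obtain ⟨γ, h, rfl, rfl, hL⟩ := exists_isHorizontalOn_lt p q hc
  have := koranyiNorm_le_of_isHorizontalOn (h.mul_left (γ 0)⁻¹) (by simp)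
  simp_rw [speed_mul_left] at this
  rw [koranyiDist_comm]
  change koranyiNorm ((γ 0)⁻¹ * γ 1) / 3 ≤ c
  linarith

/-- Points at prescribed distance along an almost shortest path: the sub-Riemannian distance is a
length distance. -/
theorem exists_between_subRiemDist {p q : Heis} {τ η : ℝ} (hτ : 0 ≤ τ)
    (hτ' : τ ≤ subRiemDist p q) (hη : 0 < η) :
    ∃ r, subRiemDist p r ≤ τ ∧ subRiemDist r q ≤ subRiemDist p q - τ + η := by
  obtain ⟨γ, h, rfl, rfl, hL⟩ := exists_isHorizontalOn_lt p q (lt_add_of_pos_right _ hη)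
  have hint := h.intervalIntegrable_speed
  have hcont : ContinuousOn (fun s => ∫ v in (0 : ℝ)..s, speed γ v) (Icc 0 1) := by
    have := intervalIntegral.continuousOn_primitive_interval' hint left_mem_uIcc
    rwa [uIcc_of_le zero_le_one] at this
  have hmem : τ ∈ Icc (∫ v in (0 : ℝ)..0, speed γ v) (∫ v in (0 : ℝ)..1, speed γ v) := by
    simp only [intervalIntegral.integral_same]
    exact ⟨hτ, hτ'.trans (h.subRiemDist_le_integral zero_le_one)⟩
  obtain ⟨s, hs, hsτ⟩ := intermediate_value_Icc zero_le_one hcont hmem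
  have hs' : s ∈ uIcc (0 : ℝ) 1 := by rwa [uIcc_of_le zero_le_one]
  have h1 : IsHorizontalOn γ 0 s := h.mono (uIcc_subset_uIcc_left hs')
  have h2 : IsHorizontalOn γ s 1 := h.mono (uIcc_subset_uIcc_right hs')
  refine ⟨γ s, (h1.subRiemDist_le_integral hs.1).trans_eq hsτ, ?_⟩
  have e := intervalIntegral.integral_add_adjacent_intervals h1.intervalIntegrable_speed
    h2.intervalIntegrable_speed
  have := h2.subRiemDist_le_integral hs.2
  simp only at hsτ
  linarith

/-! ### Homogeneous distances and the volume of their balls -/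

instance : SecondCountableTopology Heis := inferInstanceAs (SecondCountableTopology (ℝ × ℝ × ℝ))

instance : (volume : Measure Heis).IsOpenPosMeasure :=
  inferInstanceAs ((volume : Measure (ℝ × ℝ × ℝ)).IsOpenPosMeasure)

instance : IsFiniteMeasureOnCompacts (volume : Measure Heis) :=
  inferInstanceAs (IsFiniteMeasureOnCompacts (volume : Measure (ℝ × ℝ × ℝ)))

theorem continuous_x : Continuous x := continuous_fst (X := ℝ) (Y := ℝ × ℝ)

theorem continuous_y : Continuous y :=
  (continuous_fst (X := ℝ) (Y := ℝ)).comp (continuous_snd (X := ℝ) (Y := ℝ × ℝ))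

theorem continuous_t : Continuous t :=
  (continuous_snd (X := ℝ) (Y := ℝ)).comp (continuous_snd (X := ℝ) (Y := ℝ × ℝ))

theorem continuous_koranyiDist_left (q : Heis) : Continuous fun p => koranyiDist p q := by
  have hx := continuous_x
  have hy := continuous_y
  have ht := continuous_t
  unfold koranyiDist koranyiNorm
  simp only [mul_x, mul_y, mul_t, inv_x, inv_y, inv_t]
  refine Continuous.rpow_const (by fun_prop) fun p => Or.inr (by norm_num)

theorem koranyiDist_self (p : Heis) : koranyiDist p p = 0 := by
  have := koranyiDist_le_subRiemDist p p
  rw [subRiemDist_self] at this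
  exact le_antisymm (by simpa using this) (koranyiDist_nonneg p p)

theorem continuous_subRiemDist_left (q : Heis) : Continuous fun p => subRiemDist p q := by
  rw [continuous_iff_continuousAt]
  intro p₀
  have h : Filter.Tendsto (fun p => 300 * koranyiDist p p₀) (nhds p₀) (nhds 0) := by
    have := ((continuous_koranyiDist_left p₀).const_mul 300).tendsto p₀
    simpa [koranyiDist_self] using this
  refine tendsto_iff_dist_tendsto_zero.2 (squeeze_zero (fun _ => dist_nonneg) (fun p => ?_) h)
  rw [Real.dist_eq]
  refine le_trans (abs_le.2 ⟨?_, ?_⟩) (subRiemDist_le_koranyiDist p p₀)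
  · linarith [subRiemDist_triangle p₀ p q, subRiemDist_comm p p₀]
  · linarith [subRiemDist_triangle p p₀ q]

/-- A left-invariant homogeneous distance function which is comparable with the sub-Riemannian
distance. The comparison stands in for the triangle inequality. The constant `300` is one that
serves for both the Korányi and the sub-Riemannian distance. -/
structure IsHomDist (d : Heis → Heis → ℝ) : Prop where
  mul_left : ∀ g p q, d (g * p) (g * q) = d p q
  dil : ∀ R : ℝ, 0 < R → ∀ p q, d (dil R p) (dil R q) = R * d p q
  le_sub : ∀ p q, d p q ≤ 300 * subRiemDist p q
  sub_le : ∀ p q, subRiemDist p q ≤ 300 * d p q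
  continuous_left : ∀ q, Continuous fun p => d p q

theorem isHomDist_koranyiDist : IsHomDist koranyiDist where
  mul_left := koranyiDist_mul_left
  dil R hR := koranyiDist_dil hR.le
  le_sub p q := (koranyiDist_le_subRiemDist p q).trans (by linarith [subRiemDist_nonneg p q])
  sub_le := subRiemDist_le_koranyiDist
  continuous_left := continuous_koranyiDist_left

theorem isHomDist_subRiemDist : IsHomDist subRiemDist where
  mul_left := subRiemDist_mul_left
  dil R hR := subRiemDist_dil hR
  le_sub p q := by linarith [subRiemDist_nonneg p q]
  sub_le p q := by linarith [subRiemDist_nonneg p q]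
  continuous_left := continuous_subRiemDist_left

theorem map_const_add_mul (a : ℝ) {k : ℝ} (hk : 0 < k) :
    Measure.map (fun s : ℝ => a + k * s) volume = ENNReal.ofReal k⁻¹ • volume := by
  have h := Measure.map_map (μ := (volume : Measure ℝ)) (measurable_const_add a)
    (measurable_const_mul k)
  rw [Real.map_volume_mul_left hk.ne', Measure.map_smul, map_add_left_eq_self,
    abs_of_pos (inv_pos.2 hk)] at h
  exact h.symm

/-- Left translations and dilations are affine with a triangular linear part, of determinant
`R⁴`. -/
theorem map_mul_dil (c : Heis) {R : ℝ} (hR : 0 < R) :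
    Measurable (fun p : Heis => c * dil R p) ∧
    Measure.map (fun p : Heis => c * dil R p) volume = ENNReal.ofReal (R⁻¹ ^ 4) • volume := by
  set k := ENNReal.ofReal R⁻¹
  set l := ENNReal.ofReal (R ^ 2)⁻¹
  have inner : ∀ b e : ℝ, MeasurePreserving (fun p : ℝ × ℝ => (c.y + R * p.1,
      (e + b * p.1) + R ^ 2 * p.2)) (volume.prod volume)
      ((k • volume : Measure ℝ).prod (l • volume : Measure ℝ)) := by
    intro b e
    refine MeasurePreserving.skew_product (f := fun s : ℝ => c.y + R * s)
      (g := fun s u : ℝ => (e + b * s) + R ^ 2 * u)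
      ⟨by fun_prop, map_const_add_mul _ hR⟩ (by unfold Function.uncurry; fun_prop)
      (ae_of_all _ fun s => map_const_add_mul _ (by positivity))
  have outer : MeasurePreserving (fun p : ℝ × ℝ × ℝ => (c.x + R * p.1, (c.y + R * p.2.1,
      ((c.t + 2 * R * p.1 * c.y) + (-2 * c.x * R) * p.2.1) + R ^ 2 * p.2.2)))
      (volume.prod (volume.prod volume))
      ((k • volume : Measure ℝ).prod ((k • volume : Measure ℝ).prod (l • volume : Measure ℝ))) := by
    refine MeasurePreserving.skew_product (f := fun s : ℝ => c.x + R * s)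
      (g := fun (s : ℝ) (p : ℝ × ℝ) => (c.y + R * p.1,
        ((c.t + 2 * R * s * c.y) + (-2 * c.x * R) * p.1) + R ^ 2 * p.2))
      ⟨by fun_prop, map_const_add_mul _ hR⟩ (by unfold Function.uncurry; fun_prop)
      (ae_of_all _ fun s => (inner _ _).map_eq)
  have hfun : (fun p : Heis => c * dil R p) =
      (fun p : ℝ × ℝ × ℝ => (c.x + R * p.1, (c.y + R * p.2.1,
      ((c.t + 2 * R * p.1 * c.y) + (-2 * c.x * R) * p.2.1) + R ^ 2 * p.2.2))) := by
    funext p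
    refine ext_coord rfl rfl ?_
    change c.t + R ^ 2 * p.t - 2 * c.x * (R * p.y) + 2 * (R * p.x) * c.y =
      ((c.t + 2 * R * p.x * c.y) + (-2 * c.x * R) * p.y) + R ^ 2 * p.t
    ring
  have hconst : ENNReal.ofReal (R⁻¹ ^ 4) = k * (k * l) := by
    rw [← ENNReal.ofReal_mul (by positivity), ← ENNReal.ofReal_mul (by positivity)]
    congr 1
    field_simp
  have hm : (k • volume : Measure ℝ).prod ((k • volume : Measure ℝ).prod (l • volume : Measure ℝ))
      = ENNReal.ofReal (R⁻¹ ^ 4) • ((volume : Measure ℝ).prod ((volume : Measure ℝ).prod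
        (volume : Measure ℝ))) := by
    rw [hconst, Measure.prod_smul_left, Measure.prod_smul_left, Measure.prod_smul_right,
      Measure.prod_smul_right, Measure.prod_smul_right, smul_smul, smul_smul, mul_assoc]
  rw [hm] at outer
  rw [hfun]
  exact ⟨outer.measurable, outer.map_eq⟩

namespace IsHomDist

variable {d : Heis → Heis → ℝ}

theorem nonneg (hd : IsHomDist d) (p q : Heis) : 0 ≤ d p q := by
  linarith [hd.sub_le p q, subRiemDist_nonneg p q]

theorem self (hd : IsHomDist d) (p : Heis) : d p p = 0 := by
  refine le_antisymm ?_ (hd.nonneg p p)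
  simpa [subRiemDist_self] using hd.le_sub p p

theorem mem_dball (hd : IsHomDist d) (c : Heis) {r : ℝ} (hr : 0 < r) : c ∈ dball d c r := by
  change d c c < r
  rwa [hd.self]

theorem isOpen_dball (hd : IsHomDist d) (c : Heis) (r : ℝ) : IsOpen (dball d c r) :=
  isOpen_lt (hd.continuous_left c) continuous_const

theorem measurableSet_dball (hd : IsHomDist d) (c : Heis) (r : ℝ) : MeasurableSet (dball d c r) :=
  (hd.isOpen_dball c r).measurableSet

theorem dist_mul_dil (hd : IsHomDist d) (c : Heis) {R : ℝ} (hR : 0 < R) (p q : Heis) :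
    d (c * Heis.dil R p) (c * Heis.dil R q) = R * d p q := by
  rw [hd.mul_left, hd.dil R hR]

theorem preimage_dball (hd : IsHomDist d) (c : Heis) {R : ℝ} (hR : 0 < R) :
    (fun p : Heis => c * Heis.dil R p) ⁻¹' dball d c R = dball d 1 1 := by
  ext p
  have := hd.dist_mul_dil c hR p 1
  rw [dil_one, mul_one] at this
  simp only [mem_preimage, dball, mem_ofPred_eq, this]
  constructor <;> intro h <;> nlinarith

theorem volume_dball (hd : IsHomDist d) (c : Heis) {R : ℝ} (hR : 0 < R) :
    volume (dball d c R) = ENNReal.ofReal (R ^ 4) * volume (dball d 1 1) := by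
  obtain ⟨hm, he⟩ := map_mul_dil c hR
  have h := congrArg (fun μ : Measure Heis => μ (dball d c R)) he
  simp only [Measure.map_apply hm (hd.measurableSet_dball c R), hd.preimage_dball c hR,
    Measure.smul_apply, smul_eq_mul] at h
  rw [h, ← mul_assoc, ← ENNReal.ofReal_mul (by positivity)]
  have : R ^ 4 * R⁻¹ ^ 4 = 1 := by field_simp
  rw [this, ENNReal.ofReal_one, one_mul]

theorem volume_dball_pos (hd : IsHomDist d) (c : Heis) {R : ℝ} (hR : 0 < R) :
    0 < volume (dball d c R) :=
  (hd.isOpen_dball c R).measure_pos volume ⟨c, hd.mem_dball c hR⟩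

theorem volume_dball_one_lt_top (hd : IsHomDist d) : volume (dball d 1 1) < ∞ := by
  set K : Set (ℝ × ℝ × ℝ) := Icc (-900) 900 ×ˢ (Icc (-900) 900 ×ˢ Icc (-900 ^ 2) (900 ^ 2))
  have hK : IsCompact K := isCompact_Icc.prod (isCompact_Icc.prod isCompact_Icc)
  have hfin : (volume : Measure (ℝ × ℝ × ℝ)) K < ∞ := hK.measure_lt_top
  refine lt_of_le_of_lt (measure_mono (fun p hp => ?_)) hfin
  have h1 : koranyiNorm p ≤ 900 := by
    have e1 := koranyiDist_le_subRiemDist p 1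
    have e2 := hd.sub_le p 1
    have e3 : koranyiDist p 1 = koranyiNorm p := by simp [koranyiDist]
    have e4 : d p 1 < 1 := hp
    linarith
  have h0 := koranyiNorm_nonneg p
  have hx := abs_le.1 ((abs_x_le_koranyiNorm p).trans h1)
  have hy := abs_le.1 ((abs_y_le_koranyiNorm p).trans h1)
  have ht := abs_le.1 ((abs_t_le_koranyiNorm_sq p).trans (pow_le_pow_left₀ h0 h1 2))
  exact ⟨hx, hy, ht⟩

theorem volume_dball_lt_top (hd : IsHomDist d) (c : Heis) {R : ℝ} (hR : 0 < R) :
    volume (dball d c R) < ∞ := by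
  rw [hd.volume_dball c hR]
  exact ENNReal.mul_lt_top ENNReal.ofReal_lt_top hd.volume_dball_one_lt_top

/-- The measure of a boundary layer of a ball, by homogeneity alone. -/
theorem volume_diff_dball_le (hd : IsHomDist d) (c : Heis) {R θ : ℝ} (hR : 0 < R) (hθ : 0 < θ)
    (hθ' : θ ≤ 1) : volume (dball d c R \ dball d c ((1 - θ) * R)) ≤
      ENNReal.ofReal (4 * θ) * volume (dball d c R) := by
  rcases eq_or_lt_of_le hθ' with rfl | hlt
  · refine (measure_mono sdiff_subset).trans ?_
    refine le_mul_of_one_le_left' ?_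
    rw [← ENNReal.ofReal_one]
    exact ENNReal.ofReal_le_ofReal (by norm_num)
  have h1 : 0 < (1 - θ) * R := mul_pos (by linarith) hR
  have hsub : dball d c ((1 - θ) * R) ⊆ dball d c R := by
    intro p hp
    exact lt_of_lt_of_le (show d p c < (1 - θ) * R from hp) (by nlinarith)
  rw [measure_sdiff hsub (hd.measurableSet_dball _ _).nullMeasurableSet
    (hd.volume_dball_lt_top c h1).ne, hd.volume_dball c h1, hd.volume_dball c hR, ← mul_assoc,
    ← ENNReal.ofReal_mul (by positivity), tsub_le_iff_right, ← add_mul,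
    ← ENNReal.ofReal_add (by positivity) (by positivity)]
  refine mul_le_mul_left (ENNReal.ofReal_le_ofReal ?_) _
  have hb : 1 - 4 * θ ≤ (1 - θ) ^ 4 := by
    have := one_add_mul_le_pow (a := -θ) (by linarith) 4
    norm_num at this
    nlinarith [this]
  rw [mul_pow]
  nlinarith [pow_pos hR 4]

end IsHomDist

/-! ### Chains from a point of a ball to its centre -/

/-- One step of a chain of points of the ball `dball d c R` from `p` towards the centre `c`: there
is room `ρ` around `p` inside the ball, and either the centre is within distance `ε ρ`, or a point
is, at which the height `H` is larger by the factor `1 + κ`. -/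
def HasStep (d : Heis → Heis → ℝ) (c : Heis) (R ε κ : ℝ) (H : Heis → ℝ) (p : Heis) : Prop :=
  ∃ ρ > 0, dball subRiemDist p ρ ⊆ dball d c R ∧
    (subRiemDist p c ≤ ε * ρ ∨
      ∃ p' ∈ dball d c R, subRiemDist p p' ≤ ε * ρ ∧ (1 + κ) * H p ≤ H p')

/-- Balls of `d` are John domains in the following sense: from each point, a chain of steps whose
relative size is as small as desired, and along which a height function bounded from below by the
relative distance to the boundary grows geometrically, leads to the centre. -/
def HasJohnBalls (d : Heis → Heis → ℝ) : Prop :=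
  ∀ ε : ℝ, 0 < ε → ε ≤ 1 → ∃ κ > 0, ∀ (c : Heis) (R : ℝ), 0 < R → ∃ H : Heis → ℝ,
    (∀ p ∈ dball d c R, 1 - d p c / R ≤ H p ∧ H p ≤ 1) ∧
    ∀ p ∈ dball d c R, HasStep d c R ε κ H p

theorem mem_dball_iff {d : Heis → Heis → ℝ} {c p : Heis} {r : ℝ} :
    p ∈ dball d c r ↔ d p c < r := Iff.rfl

/-- By homogeneity it is enough to consider the unit ball. -/
theorem hasJohnBalls_of_unit {d : Heis → Heis → ℝ} (hd : IsHomDist d)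
    (h : ∀ ε : ℝ, 0 < ε → ε ≤ 1 → ∃ κ > 0, ∃ H : Heis → ℝ,
      (∀ p ∈ dball d 1 1, 1 - d p 1 ≤ H p ∧ H p ≤ 1) ∧
      ∀ p ∈ dball d 1 1, HasStep d 1 1 ε κ H p) : HasJohnBalls d := by
  intro ε hε hε1
  obtain ⟨κ, hκ, H, hH, hstep⟩ := h ε hε hε1
  refine ⟨κ, hκ, fun c R hR => ?_⟩
  set ψ : Heis → Heis := fun p => dil R⁻¹ (c⁻¹ * p) with hψ
  have hφψ : ∀ p, c * dil R (ψ p) = p := by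
    intro p
    simp [hψ, dil_dil, mul_inv_cancel₀ hR.ne', one_dil]
  have hψφ : ∀ p, ψ (c * dil R p) = p := by
    intro p
    simp [hψ, dil_dil, inv_mul_cancel₀ hR.ne', one_dil]
  have hc : c * dil R 1 = c := by rw [dil_one, mul_one]
  have hdψ : ∀ p, d p c = R * d (ψ p) 1 := by
    intro p
    rw [← hd.dist_mul_dil c hR, hφψ, hc]
  have hs : ∀ p q, subRiemDist p q = R * subRiemDist (ψ p) (ψ q) := by
    intro p q
    rw [← isHomDist_subRiemDist.dist_mul_dil c hR, hφψ, hφψ]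
  have hψc : ψ c = 1 := by simp [hψ, dil_one]
  have hmem : ∀ p, p ∈ dball d c R ↔ ψ p ∈ dball d 1 1 := by
    intro p
    rw [mem_dball_iff, mem_dball_iff, hdψ]
    constructor <;> intro h <;> nlinarith
  refine ⟨fun p => H (ψ p), fun p hp => ?_, fun p hp => ?_⟩
  · rw [hdψ, mul_div_cancel_left₀ _ hR.ne']
    exact hH _ ((hmem p).1 hp)
  · obtain ⟨ρ, hρ, hsub, hor⟩ := hstep _ ((hmem p).1 hp)
    refine ⟨R * ρ, by positivity, fun q hq => (hmem q).2 (hsub ?_), ?_⟩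
    · rw [mem_dball_iff, hs] at hq
      exact lt_of_mul_lt_mul_left hq hR.le
    · have scale : ∀ q, subRiemDist (ψ p) (ψ q) ≤ ε * ρ → subRiemDist p q ≤ ε * (R * ρ) := by
        intro q hq
        rw [hs]
        nlinarith
      rcases hor with h1 | ⟨p', hp', h1, h2⟩
      · exact Or.inl (scale c (by rwa [hψc]))
      · refine Or.inr ⟨c * dil R p', (hmem _).2 (by rwa [hψφ]), scale _ (by rwa [hψφ]), ?_⟩
        simpa only [hψφ] using h2

theorem hasJohnBalls_subRiemDist : HasJohnBalls subRiemDist := by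
  refine hasJohnBalls_of_unit isHomDist_subRiemDist fun ε hε hε1 =>
    ⟨ε / 2, by positivity, fun p => 1 - subRiemDist p 1,
      fun p _ => ⟨le_rfl, by linarith [subRiemDist_nonneg p 1]⟩, fun p hp => ?_⟩
  rw [mem_dball_iff] at hp
  refine ⟨1 - subRiemDist p 1, by linarith, fun q hq => ?_, ?_⟩
  · rw [mem_dball_iff] at hq ⊢
    linarith [subRiemDist_triangle q p 1]
  · set D := subRiemDist p 1 with hD
    have hτ : 0 < ε * (1 - D) := mul_pos hε (by linarith)
    rcases le_total D (ε * (1 - D)) with h | h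
    · exact Or.inl h
    · obtain ⟨q, h1, h2⟩ := exists_between_subRiemDist hτ.le h (half_pos hτ)
      refine Or.inr ⟨q, ?_, h1, ?_⟩
      · rw [mem_dball_iff]
        linarith
      · linarith

/-- A point at horizontal distance `w` from the vertical axis and of height `h = S²` has room of
the order of `h / (w + √h)` around it in the unit Korányi ball. -/
theorem koranyi_room {x y t a b τ w S σ : ℝ} (hw : 0 ≤ w) (hw2 : w ^ 2 = x ^ 2 + y ^ 2)
    (hS : 0 < S) (hS2 : S ^ 2 = 1 - ((x ^ 2 + y ^ 2) ^ 2 + t ^ 2)) (hσ : 0 ≤ σ)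
    (hσ' : σ * (20 * (w + S)) ≤ S ^ 2) (hab : a ^ 2 + b ^ 2 ≤ σ ^ 2) (hτ : |τ| ≤ σ ^ 2) :
    ((x + a) ^ 2 + (y + b) ^ 2) ^ 2 + (t + τ - 2 * x * b + 2 * a * y) ^ 2 < 1 := by
  have hwσ : 0 ≤ w * σ := mul_nonneg hw hσ
  have c0 : (x * a + y * b) ^ 2 + (a * y - x * b) ^ 2 ≤ (w * σ) ^ 2 := by
    have : (x * a + y * b) ^ 2 + (a * y - x * b) ^ 2 = w ^ 2 * (a ^ 2 + b ^ 2) := by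
      rw [hw2]; ring
    rw [this, mul_pow]
    exact mul_le_mul_of_nonneg_left hab (sq_nonneg _)
  have c1 : |x * a + y * b| ≤ w * σ :=
    abs_le_of_sq_le_sq (by nlinarith [sq_nonneg (a * y - x * b)]) hwσ
  have c2 : |a * y - x * b| ≤ w * σ :=
    abs_le_of_sq_le_sq (by nlinarith [sq_nonneg (x * a + y * b)]) hwσ
  set e := 2 * (w * σ) + σ ^ 2 with he
  have he0 : 0 ≤ e := by positivity
  have hS1 : S ^ 2 ≤ 1 := by rw [hS2]; nlinarith [sq_nonneg (x ^ 2 + y ^ 2), sq_nonneg t]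
  have e1 : w * σ ≤ S ^ 2 / 20 := by nlinarith [mul_nonneg hσ hS.le]
  have e2 : σ ≤ S / 20 := by
    have h1 : σ * (20 * S) ≤ S * S := by nlinarith
    have := le_of_mul_le_mul_right (a := S) (by nlinarith : (σ * 20) * S ≤ S * S) hS
    linarith
  have e3 : σ ^ 2 ≤ S ^ 2 / 400 := by nlinarith
  have e4 : e ≤ S ^ 2 / 9 := by nlinarith
  set W := x ^ 2 + y ^ 2 with hW
  have hW0 : 0 ≤ W := by positivity
  have hW1 : W ≤ 1 := by nlinarith [sq_nonneg t, sq_nonneg S]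
  have ht1 : |t| ≤ 1 := abs_le_of_sq_le_sq (by nlinarith [sq_nonneg W]) zero_le_one
  have f1 : (x + a) ^ 2 + (y + b) ^ 2 ≤ W + e := by
    nlinarith [(abs_le.1 c1).2]
  have f2 : |t + τ - 2 * x * b + 2 * a * y| ≤ |t| + e := by
    have : t + τ - 2 * x * b + 2 * a * y = t + τ + 2 * (a * y - x * b) := by ring
    rw [this]
    have g1 := abs_add_le (t + τ) (2 * (a * y - x * b))
    have g2 := abs_add_le t τ
    rw [abs_mul, abs_two] at g1
    linarith
  have f3 : ((x + a) ^ 2 + (y + b) ^ 2) ^ 2 ≤ (W + e) ^ 2 :=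
    pow_le_pow_left₀ (by positivity) f1 2
  have f4 : (t + τ - 2 * x * b + 2 * a * y) ^ 2 ≤ (|t| + e) ^ 2 := by
    rw [← sq_abs]
    exact pow_le_pow_left₀ (abs_nonneg _) f2 2
  have f5 : (|t| + e) ^ 2 = t ^ 2 + 2 * e * |t| + e ^ 2 := by
    rw [add_sq, sq_abs]; ring
  have g1 : e * W ≤ e := mul_le_of_le_one_right he0 hW1
  have g2 : e * |t| ≤ e := mul_le_of_le_one_right he0 ht1
  have g3 : e ^ 2 ≤ e / 9 := by
    have : e * e ≤ e * (1 / 9) := mul_le_mul_of_nonneg_left (by linarith) he0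
    linarith
  have f6 : (W + e) ^ 2 = W ^ 2 + 2 * (e * W) + e ^ 2 := by ring
  have hS3 : 0 < S ^ 2 := by positivity
  linarith

/-- The horizontal step, against the horizontal gradient of the fourth power `F` of the Korányi
norm. -/
theorem koranyi_horizontal_step {x y t w r F : ℝ} (hw : 0 < w) (hw2 : w ^ 2 = x ^ 2 + y ^ 2)
    (hF : F = (x ^ 2 + y ^ 2) ^ 2 + t ^ 2) (hF1 : F ≤ 1) (hr : 0 ≤ r) (hrw : r ≤ w)
    (hr4 : r ≤ 1 / 4) {a b : ℝ}
    (ha : a = -(r / w) * (w ^ 2 * x + t * y)) (hb : b = -(r / w) * (w ^ 2 * y - t * x)) :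
    (a ^ 2 + b ^ 2) ^ 2 ≤ r ^ 4 ∧
    ((x + a) ^ 2 + (y + b) ^ 2) ^ 2 + (t - 2 * x * b + 2 * a * y) ^ 2 ≤ F * (1 - r * w) := by
  have hF0 : 0 ≤ F := by rw [hF]; positivity
  set l := r / w with hl
  have hlw : l * w = r := div_mul_cancel₀ _ hw.ne'
  rw [← hw2] at hF
  have hab : a ^ 2 + b ^ 2 = r ^ 2 * F := by
    rw [ha, hb, hF, ← hlw]
    linear_combination (-l ^ 2 * (w ^ 4 + t ^ 2)) * hw2
  have hxab : x * a + y * b = -l * w ^ 4 := by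
    rw [ha, hb]
    linear_combination (l * w ^ 2) * hw2
  have hyab : a * y - x * b = -l * t * w ^ 2 := by
    rw [ha, hb]
    linear_combination (l * t) * hw2
  constructor
  · rw [hab]
    have : r ^ 2 * F ≤ r ^ 2 := mul_le_of_le_one_right (sq_nonneg _) hF1
    calc (r ^ 2 * F) ^ 2 ≤ (r ^ 2) ^ 2 := pow_le_pow_left₀ (by positivity) this 2
      _ = r ^ 4 := by ring
  · have E1 : (x + a) ^ 2 + (y + b) ^ 2 = w ^ 2 * (1 - 2 * (r * w)) + r ^ 2 * F := by
      have : (x + a) ^ 2 + (y + b) ^ 2 = w ^ 2 + 2 * (x * a + y * b) + (a ^ 2 + b ^ 2) := by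
        rw [hw2]; ring
      rw [this, hab, hxab, ← hlw]; ring
    have E2 : t - 2 * x * b + 2 * a * y = t * (1 - 2 * (r * w)) := by
      have : t - 2 * x * b + 2 * a * y = t + 2 * (a * y - x * b) := by ring
      rw [this, hyab, ← hlw]; ring
    rw [E1, E2]
    have hw1 : w ≤ 1 := by
      by_contra hc
      have : 1 < w ^ 4 := one_lt_pow₀ (not_le.1 hc) (by norm_num)
      nlinarith [sq_nonneg t]
    set e := r * w with he
    have he0 : 0 ≤ e := by positivity
    have he4 : e ≤ 1 / 4 := by nlinarith
    have hr4e : r ^ 4 ≤ e / 16 := by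
      have h1 : r * r ≤ e := mul_le_mul_of_nonneg_left hrw hr
      have h2 : r * r ≤ 1 / 16 := by nlinarith
      calc r ^ 4 = (r * r) * (r * r) := by ring
        _ ≤ e * (1 / 16) := mul_le_mul h1 h2 (by positivity) he0
        _ = e / 16 := by ring
    have key : (w ^ 2 * (1 - 2 * e) + r ^ 2 * F) ^ 2 + (t * (1 - 2 * e)) ^ 2 =
        F * ((1 - 2 * e) ^ 2 + 2 * (1 - 2 * e) * e ^ 2 + r ^ 4 * F) := by
      rw [he, hF]; ring
    rw [key]
    refine mul_le_mul_of_nonneg_left ?_ hF0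
    have h3 : r ^ 4 * F ≤ r ^ 4 := mul_le_of_le_one_right (by positivity) hF1
    nlinarith [mul_nonneg he0 he0, mul_nonneg (mul_nonneg he0 he0) he0]

theorem hasJohnBalls_koranyiDist : HasJohnBalls koranyiDist := by
  refine hasJohnBalls_of_unit isHomDist_koranyiDist fun ε hε hε1 => ?_
  -- a step of Korányi length `r` with `300 * r ≤ ε * ρ` stays within the sub-Riemannian distance
  -- `ε * ρ`; with `ρ = S ^ 2 / (60 * (w + S))`, this dictates the numerical constants:
  -- `η` is the size of the central region, `β` the relative size of the steps
  set η := ε / 72000 with hη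
  set β := η / 2 with hβ
  have hη0 : 0 < η := by positivity
  have hη1 : η ≤ 1 / 72000 := by rw [hη]; linarith
  have hβ0 : 0 < β := by positivity
  have hβ1 : β ≤ 1 / 4 := by rw [hβ]; linarith
  have hN1 : ∀ p, koranyiDist p 1 = koranyiNorm p := fun p => by simp [koranyiDist]
  refine ⟨η ^ 4 * β ^ 2 / 8, by positivity, fun p => 1 - koranyiNorm p ^ 4, fun p hp => ?_,
    fun p hp => ?_⟩
  · rw [mem_dball_iff, hN1] at hp
    have h0 := koranyiNorm_nonneg p
    rw [hN1]
    refine ⟨?_, by linarith [pow_nonneg h0 4]⟩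
    have : koranyiNorm p ^ 4 ≤ koranyiNorm p := pow_le_of_le_one h0 hp.le (by norm_num)
    linarith
  · rw [mem_dball_iff, hN1] at hp
    have h0 := koranyiNorm_nonneg p
    set F := koranyiNorm p ^ 4 with hFdef
    have hF : F = (p.x ^ 2 + p.y ^ 2) ^ 2 + p.t ^ 2 := koranyiNorm_pow_four p
    have hF1 : F < 1 := pow_lt_one₀ h0 hp (by norm_num)
    have hF0 : 0 ≤ F := by positivity
    set w := Real.sqrt (p.x ^ 2 + p.y ^ 2) with hwdef
    have hw : 0 ≤ w := Real.sqrt_nonneg _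
    have hw2 : w ^ 2 = p.x ^ 2 + p.y ^ 2 := Real.sq_sqrt (by positivity)
    set S := Real.sqrt (1 - F) with hSdef
    have hS : 0 < S := Real.sqrt_pos.2 (by linarith)
    have hS2 : S ^ 2 = 1 - F := Real.sq_sqrt (by linarith)
    have hS1 : S ≤ 1 := by nlinarith
    have hw4 : w ^ 4 ≤ F := by rw [hF, ← hw2]; nlinarith [sq_nonneg p.t]
    have hw1 : w ≤ 1 := by
      by_contra hc
      have : 1 < w ^ 4 := one_lt_pow₀ (not_le.1 hc) (by norm_num)
      linarith
    have hwS : 0 < w + S := by linarith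
    set ρ := S ^ 2 / (60 * (w + S)) with hρdef
    have hρ : ρ * (60 * (w + S)) = S ^ 2 := div_mul_cancel₀ _ (by positivity)
    have hρ0 : 0 < ρ := by positivity
    have toball : ∀ q : Heis, (q.x ^ 2 + q.y ^ 2) ^ 2 + q.t ^ 2 < 1 → q ∈ dball koranyiDist 1 1 := by
      intro q hq
      rw [mem_dball_iff, hN1]
      rw [← koranyiNorm_pow_four] at hq
      exact lt_of_pow_lt_pow_left₀ 4 zero_le_one (by simpa using hq)
    refine ⟨ρ, hρ0, fun q hq => toball q ?_, ?_⟩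
    · rw [mem_dball_iff] at hq
      set v := p⁻¹ * q with hv
      have hq' : q = p * v := by simp [hv]
      have hNv : koranyiNorm v ≤ 3 * ρ := by
        have := koranyiDist_le_subRiemDist q p
        change koranyiNorm v ≤ _ at this
        linarith
      have hNv2 : koranyiNorm v ^ 2 ≤ (3 * ρ) ^ 2 :=
        pow_le_pow_left₀ (koranyiNorm_nonneg v) hNv 2
      rw [hq']
      simp only [mul_x, mul_y, mul_t]
      refine koranyi_room hw hw2 hS (by rw [hS2, hF]) (by positivity : 0 ≤ 3 * ρ) (by linarith)
        ((sq_add_sq_le_koranyiNorm_sq v).trans hNv2) ((abs_t_le_koranyiNorm_sq v).trans hNv2)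
    rcases le_total (koranyiNorm p) η with hcen | hfar
    · left
      have e1 := subRiemDist_le_koranyiDist p 1
      rw [hN1] at e1
      have e2 : F ≤ 1 / 2 := by
        have : F ≤ koranyiNorm p := pow_le_of_le_one h0 hp.le (by norm_num)
        linarith
      have e3 : 1 / 240 ≤ ρ := by
        rw [hρdef, le_div_iff₀ (by positivity)]
        linarith
      calc subRiemDist p 1 ≤ 300 * η := by linarith
        _ = ε * (1 / 240) := by rw [hη]; ring
        _ ≤ ε * ρ := mul_le_mul_of_nonneg_left e3 hε.le
    right
    have hFη : η ^ 4 ≤ F := pow_le_pow_left₀ hη0.le hfar 4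
    set r := β * S ^ 2 / (w + S) with hrdef
    have hr : r * (w + S) = β * S ^ 2 := div_mul_cancel₀ _ hwS.ne'
    have hr0 : 0 < r := by positivity
    have hrρ : 300 * r ≤ ε * ρ := by
      have e1 : 300 * r = 300 * 60 * β * ρ := by
        rw [hrdef, hρdef]
        field_simp
      rw [e1, hβ, hη]
      nlinarith [mul_pos hε hρ0]
    have hrβ : r ≤ β * S := by
      rw [hrdef, div_le_iff₀ hwS]
      nlinarith [mul_nonneg (mul_nonneg hβ0.le hS.le) hw]
    have hβS : β * S ≤ β := mul_le_of_le_one_right hβ0.le hS1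
    -- the properties of the new point `p * v` that remain to be checked
    have finish : ∀ v : Heis, (v.x ^ 2 + v.y ^ 2) ^ 2 + v.t ^ 2 ≤ r ^ 4 →
        ((p * v).x ^ 2 + (p * v).y ^ 2) ^ 2 + (p * v).t ^ 2 ≤ F - η ^ 4 * β ^ 2 / 8 * S ^ 2 →
        ∃ p' ∈ dball koranyiDist 1 1, subRiemDist p p' ≤ ε * ρ ∧
          (1 + η ^ 4 * β ^ 2 / 8) * (1 - F) ≤ 1 - koranyiNorm p' ^ 4 := by
      intro v hv hv'
      have hpos : 0 ≤ η ^ 4 * β ^ 2 / 8 * S ^ 2 := by positivity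
      refine ⟨p * v, toball _ (by linarith), ?_, ?_⟩
      · have e1 := subRiemDist_le_koranyiDist (p * v) p
        have e2 : koranyiDist (p * v) p = koranyiNorm v := by simp [koranyiDist]
        rw [subRiemDist_comm, e2] at e1
        linarith [koranyiNorm_le_of hr0.le hv]
      · rw [koranyiNorm_pow_four, ← hS2]
        linarith
    rcases le_or_gt (β * S) w with hA | hB
    · have hw0 : 0 < w := lt_of_lt_of_le (by positivity) hA
      obtain ⟨h1, h2⟩ := koranyi_horizontal_step hw0 hw2 hF hF1.le hr0.le (hrβ.trans hA)
        (by linarith) rfl rfl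
      refine finish (mk _ _ 0) (by simpa only [x_mk, y_mk, t_mk, ne_eq, OfNat.ofNat_ne_zero,
        not_false_eq_true, zero_pow, add_zero] using h1) ?_
      simp only [mul_x, mul_y, mul_t, x_mk, y_mk, t_mk, add_zero]
      refine h2.trans ?_
      have hrw : β ^ 2 * S ^ 2 / 2 ≤ r * w := by
        have e1 : β * (w + S) ≤ 2 * w := by
          linarith [mul_le_of_le_one_left hw (by linarith : β ≤ 1)]
        have e2 : β ^ 2 * S ^ 2 * (w + S) ≤ 2 * (r * w) * (w + S) := by
          calc β ^ 2 * S ^ 2 * (w + S) = (β * S ^ 2) * (β * (w + S)) := by ring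
            _ ≤ (β * S ^ 2) * (2 * w) := mul_le_mul_of_nonneg_left e1 (by positivity)
            _ = 2 * (r * w) * (w + S) := by rw [← hr]; ring
        linarith [le_of_mul_le_mul_right e2 hwS]
      have e3 : η ^ 4 * (β ^ 2 * S ^ 2 / 2) ≤ F * (r * w) :=
        mul_le_mul hFη hrw (by positivity) hF0
      have e4 : 0 ≤ η ^ 4 * (β ^ 2 * S ^ 2) := by positivity
      have e5 : F * (1 - r * w) = F - F * (r * w) := by ring
      linarith
    · -- close to the vertical axis, where `|t|` is bounded from below
      have hwβ : w ≤ β := by linarith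
      have e1 : w ^ 4 ≤ β ^ 4 := pow_le_pow_left₀ hw hwβ 4
      have e2 : (η ^ 2 / 2) ^ 2 ≤ |p.t| ^ 2 := by
        rw [sq_abs]
        have : p.t ^ 2 = F - w ^ 4 := by rw [hF, ← hw2]; ring
        rw [this]
        have : β ^ 4 = η ^ 4 / 16 := by rw [hβ]; ring
        have e4 : (η ^ 2 / 2) ^ 2 = η ^ 4 / 4 := by ring
        linarith [pow_pos hη0 4]
      have ht : η ^ 2 / 2 ≤ |p.t| := le_of_pow_le_pow_left₀ two_ne_zero (abs_nonneg _) e2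
      have hr2 : r ^ 2 ≤ |p.t| := by
        have e3 : r ^ 2 ≤ β ^ 2 := pow_le_pow_left₀ hr0.le (hrβ.trans hβS) 2
        have : β ^ 2 = η ^ 2 / 4 := by rw [hβ]; ring
        linarith [sq_nonneg η]
      have hrS : β * S / 2 ≤ r := by
        rw [hrdef, le_div_iff₀ hwS]
        have e3 : β * S ≤ S := mul_le_of_le_one_left hS.le (by linarith)
        have e4 : β * S / 2 * (w + S) ≤ β * S / 2 * (2 * S) :=
          mul_le_mul_of_nonneg_left (by linarith) (by positivity)
        linarith
      have hrS2 : β ^ 2 * S ^ 2 / 4 ≤ r ^ 2 := by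
        have e3 := pow_le_pow_left₀ (by positivity) hrS 2
        have e4 : (β * S / 2) ^ 2 = β ^ 2 * S ^ 2 / 4 := by ring
        linarith
      have hdec : η ^ 4 * β ^ 2 / 8 * S ^ 2 ≤ |p.t| * r ^ 2 := by
        have e3 : η ^ 2 / 2 * (β ^ 2 * S ^ 2 / 4) ≤ |p.t| * r ^ 2 :=
          mul_le_mul ht hrS2 (by positivity) (abs_nonneg _)
        have e4 : η ^ 4 ≤ η ^ 2 := pow_le_pow_of_le_one hη0.le (by linarith) (by norm_num)
        have e5 : 0 ≤ β ^ 2 * S ^ 2 := by positivity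
        linarith [mul_le_mul_of_nonneg_right e4 e5]
      obtain ⟨s, hs, hst⟩ : ∃ s : ℝ, s ^ 2 = 1 ∧ s * p.t = |p.t| := by
        rcases le_total 0 p.t with h | h
        · exact ⟨1, by norm_num, by rw [abs_of_nonneg h, one_mul]⟩
        · exact ⟨-1, by norm_num, by rw [abs_of_nonpos h]; ring⟩
      refine finish (mk 0 0 (-(s * r ^ 2))) ?_ ?_
      · simp only [x_mk, y_mk, t_mk]
        have : (-(s * r ^ 2)) ^ 2 = s ^ 2 * r ^ 4 := by ring
        rw [this, hs]
        norm_num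
      · simp only [mul_x, mul_y, mul_t, x_mk, y_mk, t_mk]
        have : ((p.x + 0) ^ 2 + (p.y + 0) ^ 2) ^ 2 +
            (p.t + -(s * r ^ 2) - 2 * p.x * 0 + 2 * 0 * p.y) ^ 2 =
            F - 2 * (s * p.t) * r ^ 2 + s ^ 2 * r ^ 4 := by rw [hF]; ring
        rw [this, hs, hst]
        have e5 : r ^ 4 ≤ |p.t| * r ^ 2 := by
          calc r ^ 4 = r ^ 2 * r ^ 2 := by ring
            _ ≤ |p.t| * r ^ 2 := mul_le_mul_of_nonneg_right hr2 (sq_nonneg r)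
        linarith

/-! ### Mean oscillations -/

theorem lintegral_le_of_meanOsc_le {u : Heis → ℝ} {B : Set Heis} {M : ℝ≥0∞}
    (hB0 : volume B ≠ 0) (hB : volume B ≠ ∞) (h : meanOsc u B ≤ M) :
    ∫⁻ p in B, ‖u p - ⨍ q in B, u q‖ₑ ≤ M * volume B := by
  rw [meanOsc, setLAverage_eq] at h
  exact (ENNReal.div_le_iff hB0 hB).1 h

theorem enorm_average_sub_mul_le {u : Heis → ℝ} {B : Set Heis} (hB0 : volume B ≠ 0)
    (hB : volume B ≠ ∞) (hu : IntegrableOn u B) (a : ℝ) :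
    ‖(⨍ q in B, u q) - a‖ₑ * volume B ≤ ∫⁻ p in B, ‖u p - a‖ₑ := by
  have hconst : IntegrableOn (fun _ : Heis => a) B := integrableOn_const hB
  have hreal : volume.real B ≠ 0 := (measureReal_ne_zero_iff hB).2 hB0
  have e1 : ((⨍ q in B, u q) - a) * volume.real B = ∫ p in B, (u p - a) := by
    rw [integral_sub hu hconst, setAverage_eq, setIntegral_const, smul_eq_mul, smul_eq_mul]
    field_simp
  have e2 : ‖(⨍ q in B, u q) - a‖ₑ * volume B = ‖∫ p in B, (u p - a)‖ₑ := by
    rw [← e1, enorm_mul, Real.enorm_of_nonneg measureReal_nonneg, ofReal_measureReal hB]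
  rw [e2]
  exact enorm_integral_le_lintegral_enorm _

/-- Up to a factor `2`, the mean may be replaced with any other constant. -/
theorem meanOsc_le_of_lintegral_le {u : Heis → ℝ} {B : Set Heis} (hB0 : volume B ≠ 0)
    (hB : volume B ≠ ∞) (hu : AEStronglyMeasurable u (volume.restrict B)) (a : ℝ) {M : ℝ≥0∞}
    (hM : M ≠ ∞) (h : ∫⁻ p in B, ‖u p - a‖ₑ ≤ M * volume B) : meanOsc u B ≤ 2 * M := by
  have hfin : IntegrableOn (fun p => u p - a) B :=
    ⟨hu.sub aestronglyMeasurable_const, h.trans_lt (ENNReal.mul_lt_top hM.lt_top hB.lt_top)⟩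
  have hint : IntegrableOn u B := by
    refine (hfin.add (integrableOn_const hB (C := a))).congr (ae_of_all _ fun p => ?_)
    simp
  have h1 := (enorm_average_sub_mul_le hB0 hB hint a).trans h
  rw [meanOsc, setLAverage_eq]
  refine (ENNReal.div_le_iff hB0 hB).2 ?_
  set b := ⨍ q in B, u q
  calc ∫⁻ p in B, ‖u p - b‖ₑ ≤ ∫⁻ p in B, (‖u p - a‖ₑ + ‖b - a‖ₑ) := by
        refine lintegral_mono fun p => ?_
        have : u p - b = (u p - a) - (b - a) := by ring
        rw [this]
        exact enorm_sub_le
    _ = (∫⁻ p in B, ‖u p - a‖ₑ) + ‖b - a‖ₑ * volume B := by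
        rw [lintegral_add_right _ measurable_const, setLIntegral_const]
    _ ≤ M * volume B + M * volume B := add_le_add h h1
    _ = 2 * M * volume B := by ring

/-- The mean over a part of `B` that has a sizable proportion of the measure of `B` differs little
from the mean over `B`. -/
theorem enorm_average_sub_average_le {u : Heis → ℝ} {A B : Set Heis} {k M : ℝ≥0∞}
    (hA0 : volume A ≠ 0) (hB : volume B ≠ ∞) (hAB : A ⊆ B) (hk : volume B ≤ k * volume A)
    (hu : IntegrableOn u B) (h : meanOsc u B ≤ M) :
    ‖(⨍ q in A, u q) - ⨍ q in B, u q‖ₑ ≤ M * k := by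
  have hA : volume A ≠ ∞ := ((measure_mono hAB).trans_lt hB.lt_top).ne
  have hB0 : volume B ≠ 0 := fun h0 => hA0 (measure_mono_null hAB h0)
  have h1 := enorm_average_sub_mul_le hA0 hA (hu.mono_set hAB) (⨍ q in B, u q)
  have h2 := lintegral_le_of_meanOsc_le hB0 hB h
  refine (ENNReal.mul_le_mul_iff_left hA0 hA).1 ?_
  calc _ ≤ ∫⁻ p in A, ‖u p - ⨍ q in B, u q‖ₑ := h1
    _ ≤ ∫⁻ p in B, ‖u p - ⨍ q in B, u q‖ₑ := lintegral_mono_set hAB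
    _ ≤ M * volume B := h2
    _ ≤ M * (k * volume A) := by gcongr
    _ = M * k * volume A := by ring

theorem integrableOn_of_meanOsc_le {u : Heis → ℝ} {B : Set Heis} {M : ℝ≥0}
    (hB : volume B ≠ ∞) (hu : AEStronglyMeasurable u (volume.restrict B))
    (h : meanOsc u B ≤ M) : IntegrableOn u B := by
  by_contra hn
  rw [meanOsc_eq_top hu hB hn] at h
  exact absurd h (by simp)

theorem IsHomDist.volume_dball_le_mul {d : Heis → Heis → ℝ} (hd : IsHomDist d) (c c' : Heis)
    {r s k : ℝ} (hr : 0 < r) (hs : 0 < s) (h : r ≤ k * s) :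
    volume (dball d c r) ≤ ENNReal.ofReal (k ^ 4) * volume (dball d c' s) := by
  rw [hd.volume_dball c hr, hd.volume_dball c' hs, ← mul_assoc, ← ENNReal.ofReal_mul (by positivity),
    ← mul_pow]
  gcongr

/-! ### The distance to the complement -/

/-- The sub-Riemannian distance from `p` to the complement of `D`. -/
noncomputable def depth (D : Set Heis) (p : Heis) : ℝ := sInf (subRiemDist p '' Dᶜ)

theorem depth_le {D : Set Heis} {p q : Heis} (hq : q ∉ D) : depth D p ≤ subRiemDist p q := by
  refine csInf_le ⟨0, ?_⟩ ⟨q, hq, rfl⟩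
  rintro _ ⟨z, -, rfl⟩
  exact subRiemDist_nonneg p z

theorem le_depth {D : Set Heis} (hD : Dᶜ.Nonempty) {p : Heis} {ρ : ℝ}
    (h : dball subRiemDist p ρ ⊆ D) : ρ ≤ depth D p := by
  refine le_csInf (hD.image _) ?_
  rintro _ ⟨z, hz, rfl⟩
  by_contra hlt
  refine hz (h ?_)
  rw [mem_dball_iff, subRiemDist_comm]
  exact not_le.1 hlt

theorem mem_of_lt_depth {D : Set Heis} {p q : Heis} (h : subRiemDist p q < depth D p) : q ∈ D := by
  by_contra hq
  exact absurd (depth_le hq) (not_le.2 h)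

theorem depth_le_add {D : Set Heis} (hD : Dᶜ.Nonempty) (p q : Heis) :
    depth D p ≤ depth D q + subRiemDist p q := by
  rw [← sub_le_iff_le_add]
  refine le_csInf (hD.image _) ?_
  rintro _ ⟨z, hz, rfl⟩
  have h1 : depth D p ≤ subRiemDist p z := depth_le hz
  have h2 := subRiemDist_triangle p q z
  linarith

theorem IsHomDist.compl_dball_nonempty {d : Heis → Heis → ℝ} (hd : IsHomDist d) (c : Heis)
    {R : ℝ} (hR : 0 < R) : (dball d c R)ᶜ.Nonempty := by
  refine ⟨c * Heis.dil R (Heis.mk 900 0 0), fun h => ?_⟩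
  have e := hd.dist_mul_dil c hR (Heis.mk 900 0 0) 1
  rw [dil_one, mul_one] at e
  rw [mem_dball_iff, e] at h
  have h1 := abs_x_le_koranyiNorm (Heis.mk 900 0 0)
  have h2 := koranyiDist_le_subRiemDist (Heis.mk 900 0 0) 1
  have h3 : koranyiDist (Heis.mk 900 0 0) 1 = koranyiNorm (Heis.mk 900 0 0) := by simp [koranyiDist]
  have h4 := hd.sub_le (Heis.mk 900 0 0) 1
  simp only [x_mk] at h1
  rw [abs_of_pos (by norm_num)] at h1
  nlinarith

/-! ### From local to global oscillation bounds -/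

/-- The mean of `u` over a ball around `p` whose radius is a small multiple of the distance from
`p` to the complement of `D`. The parameter `n` enlarges balls in the local condition. -/
noncomputable def localMean (d : Heis → Heis → ℝ) (n : ℝ) (D : Set Heis) (u : Heis → ℝ)
    (p : Heis) : ℝ :=
  ⨍ q in dball d p (depth D p / (4 * 300 ^ 3 * n)), u q

section LocalMean

variable {d : Heis → Heis → ℝ} {n : ℝ} {D : Set Heis} {u : Heis → ℝ} {M : ℝ≥0}

theorem IsHomDist.dball_subset_of_mul_le (hd : IsHomDist d) {p : Heis} {r : ℝ}
    (h : 300 * r ≤ depth D p) : dball d p r ⊆ D := by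
  intro q hq
  refine mem_of_lt_depth (p := p) ?_
  rw [mem_dball_iff] at hq
  rw [subRiemDist_comm]
  linarith [hd.sub_le q p]

/-- Both small balls lie in one admissible ball around `p`, of comparable measure. -/
theorem IsHomDist.exists_forall_enorm_localMean_sub_le (hd : IsHomDist d) (hn : 1 < n)
    (hD : Dᶜ.Nonempty) (hu : AEStronglyMeasurable u (volume.restrict D))
    (h : ∀ (p : Heis) (r : ℝ), 0 < r → dball d p (n * r) ⊆ D → meanOsc u (dball d p r) ≤ M)
    {p : Heis} (hp : 0 < depth D p) :
    ∃ b : ℝ, ∀ q, subRiemDist p q ≤ 1 / (2 * 300 ^ 2 * n) * depth D p →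
      ‖localMean d n D u q - b‖ₑ ≤ M * ENNReal.ofReal (720000 ^ 4) := by
  have hn0 : 0 < n := by linarith
  set δ := depth D p with hδ
  set r := δ / (300 * n) with hr
  have hr0 : 0 < r := by positivity
  have hnr : 300 * (n * r) = δ := by rw [hr]; field_simp
  have hsub : dball d p (n * r) ⊆ D := hd.dball_subset_of_mul_le hnr.le
  have hsub' : dball d p r ⊆ D := by
    refine hd.dball_subset_of_mul_le ?_
    rw [← hδ, ← hnr]
    nlinarith
  have hosc := h p r hr0 hsub
  have hint : IntegrableOn u (dball d p r) :=
    integrableOn_of_meanOsc_le (hd.volume_dball_lt_top p hr0).ne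
      (hu.mono_measure (Measure.restrict_mono hsub' le_rfl)) hosc
  refine ⟨⨍ z in dball d p r, u z, fun q hq => ?_⟩
  set ε := 1 / (2 * 300 ^ 2 * n) with hε
  have hε0 : 0 < ε := by positivity
  have hε1 : ε ≤ 1 / 2 := by
    rw [hε]
    refine one_div_le_one_div_of_le (by norm_num) ?_
    nlinarith
  set a := 1 / (4 * 300 ^ 3 * n) with ha
  have ha0 : 0 < a := by positivity
  have hεa : ε = 600 * a := by rw [hε, ha]; field_simp; norm_num
  have hra : r = 360000 * (a * δ) := by rw [hr, ha]; field_simp; norm_num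
  have q1 : depth D q ≤ 2 * δ := by
    have := depth_le_add hD q p
    rw [subRiemDist_comm] at this
    nlinarith
  have q2 : δ / 2 ≤ depth D q := by
    have := depth_le_add hD p q
    nlinarith
  have hrad : depth D q / (4 * 300 ^ 3 * n) = a * depth D q := by rw [ha]; field_simp
  have hq0 : 0 < a * depth D q := mul_pos ha0 (by linarith)
  rw [localMean, hrad]
  refine enorm_average_sub_average_le (hd.volume_dball_pos q hq0).ne'
    (hd.volume_dball_lt_top p hr0).ne (fun z hz => ?_)
    (hd.volume_dball_le_mul p q hr0 hq0 ?_) hint hosc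
  · rw [mem_dball_iff] at hz ⊢
    have e1 := hd.le_sub z p
    have e2 := hd.sub_le z q
    have e3 := subRiemDist_triangle z q p
    rw [subRiemDist_comm q p] at e3
    rw [hεa] at hq
    nlinarith [mul_le_mul_of_nonneg_left q1 ha0.le]
  · rw [hra]
    nlinarith [mul_le_mul_of_nonneg_left q2 ha0.le]

theorem IsHomDist.enorm_localMean_sub_le (hd : IsHomDist d) (hn : 1 < n)
    (hD : Dᶜ.Nonempty) (hu : AEStronglyMeasurable u (volume.restrict D))
    (h : ∀ (p : Heis) (r : ℝ), 0 < r → dball d p (n * r) ⊆ D → meanOsc u (dball d p r) ≤ M)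
    {p q : Heis} (hp : 0 < depth D p)
    (hpq : subRiemDist p q ≤ 1 / (2 * 300 ^ 2 * n) * depth D p) :
    ‖localMean d n D u p - localMean d n D u q‖ₑ ≤ 2 * (M * ENNReal.ofReal (720000 ^ 4)) := by
  obtain ⟨b, hb⟩ := hd.exists_forall_enorm_localMean_sub_le hn hD hu h hp
  have hn0 : 0 < n := by linarith
  have h1 := hb p (by rw [subRiemDist_self]; positivity)
  have h2 := hb q hpq
  have : localMean d n D u p - localMean d n D u q =
      (localMean d n D u p - b) - (localMean d n D u q - b) := by ring
  rw [this, two_mul]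
  exact enorm_sub_le.trans (add_le_add h1 h2)

end LocalMean

/-- An increment bound along each step of a chain adds up to a bound by the number of steps, which
is logarithmic in the height of the starting point. -/
theorem enorm_sub_le_of_hasStep {d : Heis → Heis → ℝ} {c : Heis} {R ε κ : ℝ} {H m : Heis → ℝ}
    {A : ℝ≥0∞} (hε : 0 < ε) (hκ : 0 < κ) (hD : (dball d c R)ᶜ.Nonempty)
    (hH : ∀ p ∈ dball d c R, H p ≤ 1) (hstep : ∀ p ∈ dball d c R, HasStep d c R ε κ H p)
    (hm : ∀ p ∈ dball d c R, ∀ q, subRiemDist p q ≤ ε * depth (dball d c R) p →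
      ‖m p - m q‖ₑ ≤ A) (k : ℕ) :
    ∀ p ∈ dball d c R, 1 < (1 + κ) ^ k * H p → ‖m p - m c‖ₑ ≤ k * A := by
  induction k with
  | zero =>
    intro p hp h
    rw [pow_zero, one_mul] at h
    exact absurd (hH p hp) (not_le.2 h)
  | succ k ih =>
    intro p hp h
    obtain ⟨ρ, hρ, hsub, hor⟩ := hstep p hp
    have hle : ε * ρ ≤ ε * depth (dball d c R) p :=
      mul_le_mul_of_nonneg_left (le_depth hD hsub) hε.le
    rw [Nat.cast_succ, add_mul, one_mul]
    rcases hor with h1 | ⟨p', hp', h1, h2⟩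
    · exact (hm p hp c (h1.trans hle)).trans le_add_self
    · have e1 : 1 < (1 + κ) ^ k * H p' := by
        refine h.trans_le ?_
        rw [pow_succ, mul_assoc]
        exact mul_le_mul_of_nonneg_left h2 (by positivity)
      have e2 : m p - m c = (m p' - m c) + (m p - m p') := by ring
      rw [e2]
      exact (enorm_add_le _ _).trans (add_le_add (ih p' hp' e1) (hm p hp p' (h1.trans hle)))

/-- The number of dyadic boundary layers of the ball `dball d c R` that contain `p`. -/
noncomputable def layers (d : Heis → Heis → ℝ) (c : Heis) (R : ℝ) (p : Heis) : ℝ≥0∞ :=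
  ∑' j : ℕ, (dball d c R \ dball d c ((1 - (1 / 2) ^ j) * R)).indicator 1 p

theorem IsHomDist.measurable_layers {d : Heis → Heis → ℝ} (hd : IsHomDist d) (c : Heis) (R : ℝ) :
    Measurable (layers d c R) := by
  refine Measurable.tsum fun j => measurable_one.indicator ?_
  exact (hd.measurableSet_dball _ _).diff (hd.measurableSet_dball _ _)

theorem IsHomDist.lintegral_layers_le {d : Heis → Heis → ℝ} (hd : IsHomDist d) (c : Heis) {R : ℝ}
    (hR : 0 < R) : ∫⁻ p in dball d c R, layers d c R p ≤ 8 * volume (dball d c R) := by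
  have hmeas : ∀ j : ℕ, MeasurableSet (dball d c R \ dball d c ((1 - (1 / 2) ^ j) * R)) := fun j =>
    (hd.measurableSet_dball _ _).diff (hd.measurableSet_dball _ _)
  calc ∫⁻ p in dball d c R, layers d c R p ≤ ∫⁻ p, layers d c R p := setLIntegral_le_lintegral _ _
    _ = ∑' j : ℕ, volume (dball d c R \ dball d c ((1 - (1 / 2) ^ j) * R)) := by
        unfold layers
        rw [lintegral_tsum fun j => (measurable_one.indicator (hmeas j)).aemeasurable]
        exact tsum_congr fun j => lintegral_indicator_one (hmeas j)
    _ ≤ ∑' j : ℕ, ENNReal.ofReal (4 * (1 / 2) ^ j) * volume (dball d c R) :=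
        ENNReal.tsum_le_tsum fun j => hd.volume_diff_dball_le c hR (by positivity)
          (pow_le_one₀ (by norm_num) (by norm_num))
    _ = 8 * volume (dball d c R) := by
        rw [ENNReal.tsum_mul_right, ← ENNReal.ofReal_tsum_of_nonneg (fun j => by positivity)
          (summable_geometric_two.mul_left 4), tsum_mul_left, tsum_geometric_two]
        norm_num

/-- A point that lies in `J` layers only has relative distance larger than `2⁻ᴶ` from the
boundary. -/
theorem exists_nat_le_layers {d : Heis → Heis → ℝ} {c p : Heis} {R : ℝ} (hR : 0 < R)
    (hp : p ∈ dball d c R) :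
    ∃ J : ℕ, (1 / 2 : ℝ) ^ J < 1 - d p c / R ∧ (J : ℝ≥0∞) ≤ layers d c R p := by
  classical
  rw [mem_dball_iff] at hp
  have hpos : 0 < 1 - d p c / R := by
    rw [sub_pos, div_lt_one hR]
    exact hp
  have hex : ∃ J : ℕ, (1 / 2 : ℝ) ^ J < 1 - d p c / R :=
    exists_pow_lt_of_lt_one hpos (by norm_num)
  refine ⟨Nat.find hex, Nat.find_spec hex, ?_⟩
  have h1 : ∀ j ∈ Finset.range (Nat.find hex),
      (dball d c R \ dball d c ((1 - (1 / 2) ^ j) * R)).indicator (1 : Heis → ℝ≥0∞) p = 1 := by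
    intro j hj
    have h2 := Nat.find_min hex (Finset.mem_range.1 hj)
    have hnot : p ∉ dball d c ((1 - (1 / 2) ^ j) * R) := by
      intro hm
      rw [mem_dball_iff, ← div_lt_iff₀ hR] at hm
      exact h2 (by linarith)
    have hmem : p ∈ dball d c R \ dball d c ((1 - (1 / 2) ^ j) * R) := ⟨hp, hnot⟩
    exact indicator_of_mem hmem _
  calc (Nat.find hex : ℝ≥0∞) = ∑ j ∈ Finset.range (Nat.find hex),
        (dball d c R \ dball d c ((1 - (1 / 2) ^ j) * R)).indicator (1 : Heis → ℝ≥0∞) p := by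
        rw [Finset.sum_congr rfl h1]
        simp
    _ ≤ layers d c R p := ENNReal.sum_le_tsum _

/-- The balls `dball subRiemDist q (b * depth D q)`, `q ∈ s`, are disjoint, and the balls with
three times the radius cover `D`. -/
theorem exists_countable_disjoint_cover {D : Set Heis} {b T : ℝ} (hb : 0 < b)
    (hpos : ∀ p ∈ D, 0 < depth D p) (hT : ∀ p ∈ D, depth D p ≤ T) :
    ∃ s ⊆ D, s.Countable ∧ (s.PairwiseDisjoint fun q => dball subRiemDist q (b * depth D q)) ∧
      D ⊆ ⋃ q ∈ s, dball subRiemDist q (3 * b * depth D q) := by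
  have hself : ∀ p ∈ D, p ∈ dball subRiemDist p (b * depth D p) := fun p hp =>
    isHomDist_subRiemDist.mem_dball p (mul_pos hb (hpos p hp))
  obtain ⟨s, hsD, hdisj, hcov⟩ := Vitali.exists_disjoint_subfamily_covering_enlargement
    (fun q => dball subRiemDist q (b * depth D q)) D (fun q => b * depth D q) 2 one_lt_two
    (fun p hp => (mul_pos hb (hpos p hp)).le) (b * T)
    (fun p hp => mul_le_mul_of_nonneg_left (hT p hp) hb.le) (fun p hp => ⟨p, hself p hp⟩)
  refine ⟨s, hsD, hdisj.countable_of_isOpen (fun q _ => isHomDist_subRiemDist.isOpen_dball _ _)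
    (fun q hq => ⟨q, hself q (hsD hq)⟩), hdisj, fun p hp => ?_⟩
  obtain ⟨q, hq, ⟨z, hz1, hz2⟩, hle⟩ := hcov p hp
  refine mem_iUnion₂.2 ⟨q, hq, ?_⟩
  rw [mem_dball_iff] at hz1 hz2 ⊢
  have := subRiemDist_triangle p z q
  rw [subRiemDist_comm p z] at this
  linarith

/-- The mean oscillation over a ball of one distance is controlled by the mean oscillations over
the well-contained balls of another one. -/
theorem exists_meanOsc_dball_le {d d' : Heis → Heis → ℝ} (hd : IsHomDist d)
    (hJ : HasJohnBalls d) (hd' : IsHomDist d') {n : ℝ} (hn : 1 < n) :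
    ∃ C : ℝ≥0, ∀ (c : Heis) (R : ℝ) (u : Heis → ℝ) (M : ℝ≥0), 0 < R →
      AEStronglyMeasurable u (volume.restrict (dball d c R)) →
      (∀ (p : Heis) (r : ℝ), 0 < r → dball d' p (n * r) ⊆ dball d c R →
        meanOsc u (dball d' p r) ≤ M) →
      meanOsc u (dball d c R) ≤ C * M := by
  have hn0 : 0 < n := by linarith
  set ε := 1 / (2 * 300 ^ 2 * n) with hε
  have hε0 : 0 < ε := by positivity
  have hε1 : ε ≤ 1 := by
    rw [hε, div_le_one (by positivity)]
    nlinarith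
  obtain ⟨κ, hκ, hstep⟩ := hJ ε hε0 hε1
  obtain ⟨k, hk⟩ := pow_unbounded_of_one_lt 2 (by linarith : 1 < 1 + κ)
  -- volume ratios: the radii in question differ by factors `8 * 300 ^ 2` and `3 * 300 ^ 2`
  set Λ : ℝ≥0 := Real.toNNReal (720000 ^ 4)
  set Λ' : ℝ≥0 := Real.toNNReal (270000 ^ 4)
  refine ⟨2 * (Λ' * (1 + 2 * Λ + 8 * (k * (2 * Λ)))), fun c R u M hR hu h => ?_⟩
  set D := dball d c R with hDdef
  have hD : Dᶜ.Nonempty := hd.compl_dball_nonempty c hR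
  have hDm : MeasurableSet D := hd.measurableSet_dball c R
  obtain ⟨H, hH, hs⟩ := hstep c R hR
  set A : ℝ≥0∞ := 2 * (M * Λ) with hA
  set m := localMean d' n D u with hm
  have hpos : ∀ p ∈ D, 0 < depth D p := by
    intro p hp
    obtain ⟨ρ, hρ, hsub, -⟩ := hs p hp
    exact hρ.trans_le (le_depth hD hsub)
  have hT : ∀ p ∈ D, depth D p ≤ depth D c + 300 * R := by
    intro p hp
    have h1 := depth_le_add hD p c
    have h2 := hd.sub_le p c
    have h3 : d p c < R := hp
    linarith
  have hinc : ∀ p ∈ D, ∀ q, subRiemDist p q ≤ ε * depth D p → ‖m p - m q‖ₑ ≤ A :=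
    fun p hp q hq => hd'.enorm_localMean_sub_le hn hD hu h (hpos p hp) hq
  -- the chains bound the oscillation of the local means by the number of layers
  have hmc : ∀ p ∈ D, ‖m p - m c‖ₑ ≤ k * A * layers d c R p := by
    intro p hp
    obtain ⟨J, hJ1, hJ2⟩ := exists_nat_le_layers hR hp
    have e1 : 1 < (1 + κ) ^ (k * J) * H p := by
      have e2 : (1 / 2 : ℝ) ^ J < H p := hJ1.trans_le (hH p hp).1
      have e3 : (2 : ℝ) ^ J ≤ (1 + κ) ^ (k * J) := by
        rw [pow_mul]
        exact pow_le_pow_left₀ zero_le_two hk.le J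
      calc (1 : ℝ) = 2 ^ J * (1 / 2) ^ J := by rw [← mul_pow]; norm_num
        _ < 2 ^ J * H p := mul_lt_mul_of_pos_left e2 (by positivity)
        _ ≤ (1 + κ) ^ (k * J) * H p :=
          mul_le_mul_of_nonneg_right e3 (le_trans (by positivity) e2.le)
    refine (enorm_sub_le_of_hasStep hε0 hκ hD (fun p hp => (hH p hp).2) hs hinc _ p hp e1).trans ?_
    calc ((k * J : ℕ) : ℝ≥0∞) * A = k * A * J := by push_cast; ring
      _ ≤ k * A * layers d c R p := by gcongr
  set a := 1 / (4 * 300 ^ 3 * n) with ha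
  have ha0 : 0 < a := by positivity
  set b := a / 900 with hb
  have hb0 : 0 < b := by positivity
  have hbε : b ≤ ε := by
    have : ε = 600 * a := by rw [hε, ha]; field_simp; norm_num
    rw [this, hb]
    linarith
  have hrad : ∀ q, depth D q / (4 * 300 ^ 3 * n) = a * depth D q := fun q => by
    rw [ha]; field_simp
  obtain ⟨s, hsD, hsc, hdisj, hcov⟩ := exists_countable_disjoint_cover hb0 hpos hT
  have hBsub : ∀ q ∈ s, dball subRiemDist q (b * depth D q) ⊆ D := by
    intro q hq
    have := hpos q (hsD hq)
    refine isHomDist_subRiemDist.dball_subset_of_mul_le ?_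
    have e2 : a ≤ 1 := by
      rw [ha, div_le_one (by positivity)]
      nlinarith
    have e1 : 300 * b ≤ 1 := by rw [hb]; linarith
    nlinarith
  -- the contribution of one ball of the cover
  have hone : ∀ q ∈ s, ∫⁻ p in dball subRiemDist q (3 * b * depth D q), ‖u p - m c‖ₑ ≤
      Λ' * ∫⁻ p in dball subRiemDist q (b * depth D q), (M + A + k * A * layers d c R p) := by
    intro q hq
    have hδ := hpos q (hsD hq)
    have haδ : 0 < a * depth D q := mul_pos ha0 hδ
    have hbδ : 0 < b * depth D q := mul_pos hb0 hδ
    set B := dball d' q (a * depth D q) with hB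
    set B' := dball subRiemDist q (b * depth D q) with hB'
    have hB0 := (hd'.volume_dball_pos q haδ).ne'
    have hBt := (hd'.volume_dball_lt_top q haδ).ne
    have hsub : dball subRiemDist q (3 * b * depth D q) ⊆ B := by
      intro z hz
      rw [mem_dball_iff] at hz
      rw [hB, mem_dball_iff]
      refine (hd'.le_sub z q).trans_lt ?_
      rw [hb] at hz
      linarith
    have hosc : meanOsc u B ≤ M := by
      refine h q _ haδ (hd'.dball_subset_of_mul_le ?_)
      have : 300 * (n * (a * depth D q)) = depth D q / 360000 := by
        rw [ha]; field_simp; norm_num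
      rw [this]
      linarith
    have hmq : m q = ⨍ z in B, u z := by rw [hm, localMean, hrad]
    have hvol : volume B ≤ Λ' * volume B' := by
      have e1 : B ⊆ dball subRiemDist q (300 * (a * depth D q)) := by
        intro z hz
        rw [hB, mem_dball_iff] at hz
        rw [mem_dball_iff]
        exact (hd'.sub_le z q).trans_lt (by linarith)
      refine (measure_mono e1).trans (isHomDist_subRiemDist.volume_dball_le_mul q q
        (by positivity) hbδ ?_)
      rw [hb]
      linarith
    have hmean : ∀ p ∈ B', ‖m q - m c‖ₑ ≤ A + k * A * layers d c R p := by
      intro p hp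
      have hp' : subRiemDist p q < b * depth D q := hp
      have e1 := hinc q (hsD hq) p (by
        rw [subRiemDist_comm]
        exact hp'.le.trans (mul_le_mul_of_nonneg_right hbε hδ.le))
      have e2 : m q - m c = (m q - m p) + (m p - m c) := by ring
      rw [e2]
      exact (enorm_add_le _ _).trans (add_le_add e1 (hmc p (hBsub q hq hp)))
    calc ∫⁻ p in dball subRiemDist q (3 * b * depth D q), ‖u p - m c‖ₑ
        ≤ ∫⁻ p in B, ‖u p - m c‖ₑ := lintegral_mono_set hsub
      _ ≤ ∫⁻ p in B, (‖u p - m q‖ₑ + ‖m q - m c‖ₑ) := by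
          refine lintegral_mono fun p => ?_
          have : u p - m c = (u p - m q) + (m q - m c) := by ring
          rw [this]
          exact enorm_add_le _ _
      _ = (∫⁻ p in B, ‖u p - m q‖ₑ) + ‖m q - m c‖ₑ * volume B := by
          rw [lintegral_add_right _ measurable_const, setLIntegral_const]
      _ ≤ M * volume B + ‖m q - m c‖ₑ * volume B := by
          gcongr
          rw [hmq]
          exact lintegral_le_of_meanOsc_le hB0 hBt hosc
      _ = (M + ‖m q - m c‖ₑ) * volume B := by ring
      _ ≤ (M + ‖m q - m c‖ₑ) * (Λ' * volume B') := by gcongr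
      _ = Λ' * ∫⁻ _ in B', (M + ‖m q - m c‖ₑ) := by rw [setLIntegral_const]; ring
      _ ≤ Λ' * ∫⁻ p in B', (M + A + k * A * layers d c R p) := by
          gcongr 1
          refine setLIntegral_mono' (isHomDist_subRiemDist.measurableSet_dball _ _) fun p hp => ?_
          rw [add_assoc]
          gcongr
          exact hmean p hp
  have htotal : ∫⁻ p in D, ‖u p - m c‖ₑ ≤
      Λ' * (M + A + 8 * (k * A)) * volume D := by
    have hmeas : Measurable fun p => (M : ℝ≥0∞) + A + k * A * layers d c R p :=
      measurable_const.add (measurable_const.mul (hd.measurable_layers c R))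
    have : Countable s := hsc.to_subtype
    calc ∫⁻ p in D, ‖u p - m c‖ₑ
        ≤ ∫⁻ p in ⋃ q ∈ s, dball subRiemDist q (3 * b * depth D q), ‖u p - m c‖ₑ :=
          lintegral_mono_set hcov
      _ ≤ ∑' q : s, ∫⁻ p in dball subRiemDist q (3 * b * depth D q), ‖u p - m c‖ₑ := by
          rw [biUnion_eq_iUnion]
          exact lintegral_iUnion_le _ _
      _ ≤ ∑' q : s, Λ' * ∫⁻ p in dball subRiemDist q (b * depth D q),
            (M + A + k * A * layers d c R p) := ENNReal.tsum_le_tsum fun q => hone q q.2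
      _ = Λ' * ∫⁻ p in ⋃ q ∈ s, dball subRiemDist q (b * depth D q),
            (M + A + k * A * layers d c R p) := by
          rw [ENNReal.tsum_mul_left, lintegral_biUnion hsc
            (fun q _ => isHomDist_subRiemDist.measurableSet_dball _ _) hdisj]
      _ ≤ Λ' * ∫⁻ p in D, (M + A + k * A * layers d c R p) := by
          gcongr 1
          exact lintegral_mono_set (iUnion₂_subset hBsub)
      _ = Λ' * ((M + A) * volume D + k * A * ∫⁻ p in D, layers d c R p) := by
          rw [lintegral_add_left measurable_const, setLIntegral_const,
            lintegral_const_mul _ (hd.measurable_layers c R)]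
      _ ≤ Λ' * ((M + A) * volume D + k * A * (8 * volume D)) := by
          gcongr
          exact hd.lintegral_layers_le c hR
      _ = Λ' * (M + A + 8 * (k * A)) * volume D := by ring
  have hC : (Λ' : ℝ≥0∞) * (M + A + 8 * (k * A)) =
      ((Λ' * (1 + 2 * Λ + 8 * (k * (2 * Λ))) * M : ℝ≥0) : ℝ≥0∞) := by
    rw [hA]
    push_cast
    ring
  rw [hC] at htotal
  refine (meanOsc_le_of_lintegral_le (hd.volume_dball_pos c hR).ne'
    (hd.volume_dball_lt_top c hR).ne hu (m c) ENNReal.coe_ne_top htotal).trans_eq ?_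
  push_cast
  ring

/-! ### Comparison of the seminorms -/

theorem bmoLocNorm_le_bmoNorm {d : Heis → Heis → ℝ} {n : ℝ} (hn : 1 < n) (Ω : Set Heis)
    (u : Heis → ℝ) : bmoLocNorm d n Ω u ≤ bmoNorm d Ω u := by
  refine iSup_le fun c => iSup_le fun r => iSup_le fun hr => iSup_le fun hsub => ?_
  refine le_iSup_of_le c (le_iSup_of_le r (le_iSup_of_le hr (le_iSup_of_le ?_ le_rfl)))
  refine fun p hp => hsub ?_
  rw [mem_dball_iff] at hp ⊢
  nlinarith

theorem exists_bmoNorm_le {d d' : Heis → Heis → ℝ} (hd : IsHomDist d) (hJ : HasJohnBalls d)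
    (hd' : IsHomDist d') {n : ℝ} (hn : 1 < n) :
    ∃ C : ℝ≥0, 1 ≤ C ∧ ∀ Ω : Set Heis, ∀ u : Heis → ℝ, LocallyIntegrableOn u Ω →
      bmoNorm d Ω u ≤ C * bmoLocNorm d' n Ω u := by
  obtain ⟨C, hC⟩ := exists_meanOsc_dball_le hd hJ hd' hn
  refine ⟨max C 1, le_max_right _ _, fun Ω u hu => ?_⟩
  rcases eq_or_ne (bmoLocNorm d' n Ω u) ∞ with htop | htop
  · have : ((max C 1 : ℝ≥0) : ℝ≥0∞) ≠ 0 :=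
      ENNReal.coe_ne_zero.2 (lt_of_lt_of_le one_pos (le_max_right _ _)).ne'
    rw [htop, ENNReal.mul_top this]
    exact le_top
  lift bmoLocNorm d' n Ω u to ℝ≥0 using htop with M hM
  refine iSup_le fun c => iSup_le fun R => iSup_le fun hR => iSup_le fun hsub => ?_
  refine (hC c R u M hR (hu.aestronglyMeasurable.mono_measure
    (Measure.restrict_mono hsub le_rfl)) fun p r hr hpr => ?_).trans ?_
  · rw [hM]
    exact le_iSup_of_le p (le_iSup_of_le r (le_iSup_of_le hr (le_iSup_of_le (hpr.trans hsub)
      le_rfl)))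
  · gcongr
    exact le_max_left _ _

theorem mem_BMO_iff {d : Heis → Heis → ℝ} {Ω : Set Heis} {u : Heis → ℝ} :
    u ∈ BMO d Ω ↔ LocallyIntegrableOn u Ω ∧ bmoNorm d Ω u ≠ ∞ := by
  refine and_congr_right fun _ => ⟨?_, fun h => ?_⟩
  · rintro ⟨C, hC⟩
    refine ne_top_of_le_ne_top (ENNReal.coe_ne_top (r := C)) ?_
    exact iSup_le fun c => iSup_le fun r => iSup_le fun hr => iSup_le fun hs => hC c r hr hs
  · lift bmoNorm d Ω u to ℝ≥0 using h with C hC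
    refine ⟨C, fun c r hr hs => ?_⟩
    rw [hC]
    exact le_iSup_of_le c (le_iSup_of_le r (le_iSup_of_le hr (le_iSup_of_le hs le_rfl)))

theorem mem_BMOloc_iff {d : Heis → Heis → ℝ} {n : ℝ} {Ω : Set Heis} {u : Heis → ℝ} :
    u ∈ BMOloc d n Ω ↔ LocallyIntegrableOn u Ω ∧ bmoLocNorm d n Ω u ≠ ∞ := by
  refine and_congr_right fun _ => ⟨?_, fun h => ?_⟩
  · rintro ⟨C, hC⟩
    refine ne_top_of_le_ne_top (ENNReal.coe_ne_top (r := C)) ?_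
    exact iSup_le fun c => iSup_le fun r => iSup_le fun hr => iSup_le fun hs => hC c r hr hs
  · lift bmoLocNorm d n Ω u to ℝ≥0 using h with C hC
    refine ⟨C, fun c r hr hs => ?_⟩
    rw [hC]
    exact le_iSup_of_le c (le_iSup_of_le r (le_iSup_of_le hr (le_iSup_of_le hs le_rfl)))

theorem isHomDist_and_hasJohnBalls {d : Heis → Heis → ℝ}
    (hd : d ∈ ({koranyiDist, subRiemDist} : Set (Heis → Heis → ℝ))) :
    IsHomDist d ∧ HasJohnBalls d := by
  rcases hd with rfl | rfl
  · exact ⟨isHomDist_koranyiDist, hasJohnBalls_koranyiDist⟩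
  · exact ⟨isHomDist_subRiemDist, hasJohnBalls_subRiemDist⟩

/-- One constant serves for all choices of the two distances. -/
theorem exists_forall_bmoNorm_le {n : ℝ} (hn : 1 < n) : ∃ C : ℝ≥0, 1 ≤ C ∧
    ∀ d ∈ ({koranyiDist, subRiemDist} : Set (Heis → Heis → ℝ)),
    ∀ d' ∈ ({koranyiDist, subRiemDist} : Set (Heis → Heis → ℝ)),
    ∀ (Ω : Set Heis) (u : Heis → ℝ), LocallyIntegrableOn u Ω →
      bmoNorm d Ω u ≤ C * bmoLocNorm d' n Ω u := by
  have hfin : ({koranyiDist, subRiemDist} : Set (Heis → Heis → ℝ)).Finite := toFinite _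
  have h : ∀ e : (Heis → Heis → ℝ) × (Heis → Heis → ℝ), ∃ C : ℝ≥0, 1 ≤ C ∧
      (e.1 ∈ ({koranyiDist, subRiemDist} : Set (Heis → Heis → ℝ)) →
      e.2 ∈ ({koranyiDist, subRiemDist} : Set (Heis → Heis → ℝ)) →
      ∀ (Ω : Set Heis) (u : Heis → ℝ), LocallyIntegrableOn u Ω →
        bmoNorm e.1 Ω u ≤ C * bmoLocNorm e.2 n Ω u) := by
    intro e
    by_cases h1 : e.1 ∈ ({koranyiDist, subRiemDist} : Set (Heis → Heis → ℝ))
    · by_cases h2 : e.2 ∈ ({koranyiDist, subRiemDist} : Set (Heis → Heis → ℝ))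
      · obtain ⟨C, hC, H⟩ := exists_bmoNorm_le (isHomDist_and_hasJohnBalls h1).1
          (isHomDist_and_hasJohnBalls h1).2 (isHomDist_and_hasJohnBalls h2).1 hn
        exact ⟨C, hC, fun _ _ => H⟩
      · exact ⟨1, le_rfl, fun _ h => absurd h h2⟩
    · exact ⟨1, le_rfl, fun h => absurd h h1⟩
  choose C hC H using h
  obtain ⟨K, hK⟩ := ((hfin.prod hfin).image C).bddAbove
  have hle : ∀ d ∈ ({koranyiDist, subRiemDist} : Set (Heis → Heis → ℝ)),
      ∀ d' ∈ ({koranyiDist, subRiemDist} : Set (Heis → Heis → ℝ)), C (d, d') ≤ K :=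
    fun d hd d' hd' => hK ⟨(d, d'), ⟨hd, hd'⟩, rfl⟩
  refine ⟨K, (hC (koranyiDist, koranyiDist)).trans (hle _ (by simp) _ (by simp)),
    fun d hd d' hd' Ω u hu => (H (d, d') hd hd' Ω u hu).trans ?_⟩
  gcongr
  exact hle d hd d' hd'

end Heis

/-- The first part says that for every `n > 1` all the spaces `BMO(Ω)` and `BMO_{n,loc}(Ω)`, each
taken with either of the two distances, coincide, and bounds the `BMO`-seminorm by the
`BMO_{n,loc}`-seminorm with a constant that depends on `n` only. -/
theorem theorem3p11 :
    (∀ n : ℝ, 1 < n → ∃ C : ℝ≥0, ∀ Ω : Set Heis, IsOpen Ω →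
      ∀ d ∈ ({Heis.koranyiDist, Heis.subRiemDist} : Set (Heis → Heis → ℝ)),
      ∀ d' ∈ ({Heis.koranyiDist, Heis.subRiemDist} : Set (Heis → Heis → ℝ)),
        Heis.BMO d Ω = Heis.BMOloc d' n Ω ∧
        ∀ u : Heis → ℝ, LocallyIntegrableOn u Ω →
          Heis.bmoNorm d Ω u ≤ C * Heis.bmoLocNorm d' n Ω u) ∧
    (∀ Ω : Set Heis, IsOpen Ω →
      Heis.BMO Heis.subRiemDist Ω = Heis.BMO Heis.koranyiDist Ω) ∧
    (∃ c₁ c₂ : ℝ≥0, 0 < c₁ ∧ c₁ ≤ c₂ ∧ ∀ Ω : Set Heis, IsOpen Ω →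
      ∀ u : Heis → ℝ, LocallyIntegrableOn u Ω →
        c₁ * Heis.bmoNorm Heis.koranyiDist Ω u ≤ Heis.bmoNorm Heis.subRiemDist Ω u ∧
        Heis.bmoNorm Heis.subRiemDist Ω u ≤ c₂ * Heis.bmoNorm Heis.koranyiDist Ω u) := by
  refine ⟨fun n hn => ?_, fun Ω _ => ?_, ?_⟩
  · obtain ⟨C, -, hC⟩ := Heis.exists_forall_bmoNorm_le hn
    refine ⟨C, fun Ω _ d hd d' hd' => ⟨Set.ext fun u => ?_, hC d hd d' hd' Ω⟩⟩
    rw [Heis.mem_BMO_iff, Heis.mem_BMOloc_iff]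
    refine and_congr_right fun hu => ⟨fun h => ?_, fun h => ?_⟩
    · exact ne_top_of_le_ne_top (ENNReal.mul_ne_top ENNReal.coe_ne_top h)
        ((Heis.bmoLocNorm_le_bmoNorm hn Ω u).trans ((hC d' hd' d hd Ω u hu).trans
          (mul_le_mul_right (Heis.bmoLocNorm_le_bmoNorm hn Ω u) _)))
    · exact ne_top_of_le_ne_top (ENNReal.mul_ne_top ENNReal.coe_ne_top h) (hC d hd d' hd' Ω u hu)
  · obtain ⟨C, -, hC⟩ := Heis.exists_forall_bmoNorm_le one_lt_two
    have key : ∀ d ∈ ({Heis.koranyiDist, Heis.subRiemDist} : Set (Heis → Heis → ℝ)),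
        ∀ d' ∈ ({Heis.koranyiDist, Heis.subRiemDist} : Set (Heis → Heis → ℝ)),
        Heis.BMO d' Ω ⊆ Heis.BMO d Ω := by
      intro d hd d' hd' u hu
      rw [Heis.mem_BMO_iff] at hu ⊢
      exact ⟨hu.1, ne_top_of_le_ne_top (ENNReal.mul_ne_top ENNReal.coe_ne_top hu.2)
        ((hC d hd d' hd' Ω u hu.1).trans
          (mul_le_mul_right (Heis.bmoLocNorm_le_bmoNorm one_lt_two Ω u) _))⟩
    exact Subset.antisymm (key _ (by simp) _ (by simp)) (key _ (by simp) _ (by simp))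
  · obtain ⟨C, hC1, hC⟩ := Heis.exists_forall_bmoNorm_le one_lt_two
    have hC0 : 0 < C := one_pos.trans_le hC1
    refine ⟨C⁻¹, C, inv_pos.2 hC0, (inv_le_one_of_one_le₀ hC1).trans hC1, fun Ω _ u hu => ⟨?_, ?_⟩⟩
    · rw [ENNReal.coe_inv hC0.ne', ENNReal.inv_mul_le_iff (ENNReal.coe_ne_zero.2 hC0.ne')
        ENNReal.coe_ne_top]
      exact (hC _ (by simp) _ (by simp) Ω u hu).trans
        (mul_le_mul_right (Heis.bmoLocNorm_le_bmoNorm one_lt_two Ω u) _)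
    · exact (hC _ (by simp) _ (by simp) Ω u hu).trans
        (mul_le_mul_right (Heis.bmoLocNorm_le_bmoNorm one_lt_two Ω u) _)
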